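/- Rings are associative and need not have a unit; modules over them carry no unit axiom; for a right $R$-module $M$ and a left $R$-module $N$, $M\otimes_RN$ is the quotient of $M\otimes_{\mathbb Z}N$ by the elements $mr\otimes n-m\otimes rn$. A right $R$-module $M$ is firm if the multiplication map $M\otimes_RR\to M$ is bijective (similarly on the left), $R$ is a firm ring if it is firm as a right $R$-module, and $\mathcal M_R$ is the category of firm right $R$-modules and right $R$-linear maps. A firm $R$-$A$-bimodule is an $R$-$A$-bimodule that is firm over $R$ on the left and firm over $A$ on the right. Let $A$ and $R$ be firm rings and let $\Sigma$ be a firm $R$-$A$-bimodule. Put $\Sigma^*=\mathrm{Hom}_A(\Sigma,A)$, an $A$-$R$-bimodule via $(a\varphi)(u)=a\varphi(u)$ and $(\varphi r)(u)=\varphi(ru)$, and let $Z=\Sigma\otimes_A\Sigma^*$ be the ring with multiplication $(u\otimes\varphi)(v\otimes\psi)=u\varphi(v)\otimes\psi$; it acts on $\Sigma$ by $(u\otimes\varphi)v=u\varphi(v)$. The following statements are equivalent. (i) $\Sigma$ is $R$-firmly projective: there is a ring morphism $\iota:R\to Z$ that induces the given left $R$-module structure of $\Sigma$, i.e. $ru=\iota(r)u$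 for all $r\in R$, $u\in\Sigma$ (and $\Sigma$ is firm under this structure). (ii) There are a firm $A$-$R$-bimodule $\Sigma^\dagger$ and a comatrix coring context $(R,A,\Sigma,\Sigma^\dagger,\eta,\varepsilon)$, that is, an $R$-$R$-bilinear map $\eta:R\to\Sigma\otimes_A\Sigma^\dagger$ and an $A$-$A$-bilinear map $\varepsilon:\Sigma^\dagger\otimes_R\Sigma\to A$ such that the composites $$\Sigma\cong R\otimes_R\Sigma\xrightarrow{\eta\otimes_R\Sigma}\Sigma\otimes_A\Sigma^\dagger\otimes_R\Sigma\xrightarrow{\Sigma\otimes_A\varepsilon}\Sigma\otimes_AA\cong\Sigma,$$ $$\Sigma^\dagger\cong\Sigma^\dagger\otimes_RR\xrightarrow{\Sigma^\dagger\otimes_R\eta}\Sigma^\dagger\otimes_R\Sigma\otimes_A\Sigma^\dagger\xrightarrow{\varepsilon\otimes_A\Sigma^\dagger}A\otimes_A\Sigma^\dagger\cong\Sigma^\dagger$$ are the identity maps. (iii) There is a firm $A$-$R$-bimodule $\Sigma^\dagger$ such that $-\otimes_R\Sigma:\mathcal M_R\to\mathcal M_A$ is left adjoint to $-\otimes_A\Sigma^\dagger:\mathcal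 M_A\to\mathcal M_R$. (iv) There are functors $F:\mathcal M_R\to\mathcal M_A$, $G:\mathcal M_A\to\mathcal M_R$ and $H:\mathcal M_R\to\mathcal M_A$ such that $F$ is left adjoint to $G$, $G$ is left adjoint to $H$, and $F(R)\cong\Sigma$ as $R$-$A$-bimodules, where $r\in R$ acts on $F(R)$ as the image under $F$ of the left multiplication by $r$ on $R$. Moreover, for every given firm $A$-$R$-bimodule $\Sigma^\dagger$ the following are equivalent: $\Sigma$ is $R$-firmly projective and $\Sigma^\dagger\cong\Sigma^*\otimes_RR$ as $A$-$R$-bimodules; there is a comatrix coring context $(R,A,\Sigma,\Sigma^\dagger,\eta,\varepsilon)$; $-\otimes_R\Sigma:\mathcal M_R\to\mathcal M_A$ is left adjoint to $-\otimes_A\Sigma^\dagger:\mathcal M_A\to\mathcal M_R$. -/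

import Mathlib

open CategoryTheory
open scoped TensorProduct

universe u

namespace FirmRings

section Modules

/-- A left module over an associative ring which need not have a unit (so no unit axiom). -/
class LeftModule (R M : Type*) [NonUnitalRing R] [AddCommGroup M] where
  lsmul : R → M → M
  lsmul_add : ∀ r m n, lsmul r (m + n) = lsmul r m + lsmul r n
  add_lsmul : ∀ r s m, lsmul (r + s) m = lsmul r m + lsmul s m
  mul_lsmul : ∀ r s m, lsmul (r * s) m = lsmul r (lsmul s m)

/-- A right module over an associative ring which need not have a unit. -/
class RightModule (R M : Type*) [NonUnitalRing R] [AddCommGroup M] where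
  rsmul : M → R → M
  add_rsmul : ∀ m n r, rsmul (m + n) r = rsmul m r + rsmul n r
  rsmul_add : ∀ m r s, rsmul m (r + s) = rsmul m r + rsmul m s
  rsmul_mul : ∀ m r s, rsmul m (r * s) = rsmul (rsmul m r) s

infixr:73 " •ₗ " => LeftModule.lsmul
infixl:73 " •ᵣ " => RightModule.rsmul

/-- A left `R`-module and right `A`-module is an `R`-`A`-bimodule if the two actions commute. -/
class Bimodule (R A M : Type*) [NonUnitalRing R] [NonUnitalRing A] [AddCommGroup M]
    [LeftModule R M] [RightModule A M] : Prop where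
  lsmul_rsmul : ∀ (r : R) (m : M) (a : A), (r •ₗ m) •ᵣ a = r •ₗ (m •ᵣ a)

/-- The left action as a biadditive map. -/
def lactHom (R M : Type*) [NonUnitalRing R] [AddCommGroup M] [LeftModule R M] : R →+ M →+ M :=
  AddMonoidHom.mk' (fun r => AddMonoidHom.mk' (fun m => r •ₗ m) (LeftModule.lsmul_add r))
    (fun r s => by ext m; exact LeftModule.add_lsmul r s m)

/-- The right action as a biadditive map. -/
def ractHom (R M : Type*) [NonUnitalRing R] [AddCommGroup M] [RightModule R M] : M →+ R →+ M :=
  AddMonoidHom.mk' (fun m => AddMonoidHom.mk' (fun r => m •ᵣ r) (RightModule.rsmul_add m))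
    (fun m n => by ext r; exact RightModule.add_rsmul m n r)

@[simp] theorem lactHom_apply {R M : Type*} [NonUnitalRing R] [AddCommGroup M] [LeftModule R M]
    (r : R) (m : M) : lactHom R M r m = r •ₗ m := rfl

@[simp] theorem ractHom_apply {R M : Type*} [NonUnitalRing R] [AddCommGroup M] [RightModule R M]
    (m : M) (r : R) : ractHom R M m r = m •ᵣ r := rfl

/-- Additive maps that respect the left `R`-actions. -/
def IsLeftLinear (R : Type*) {M N : Type*} [NonUnitalRing R] [AddCommGroup M] [AddCommGroup N]
    [LeftModule R M] [LeftModule R N] (f : M →+ N) : Prop :=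
  ∀ (r : R) (m : M), f (r •ₗ m) = r •ₗ f m

/-- Additive maps that respect the right `R`-actions. -/
def IsRightLinear (R : Type*) {M N : Type*} [NonUnitalRing R] [AddCommGroup M] [AddCommGroup N]
    [RightModule R M] [RightModule R N] (f : M →+ N) : Prop :=
  ∀ (m : M) (r : R), f (m •ᵣ r) = f m •ᵣ r

instance (R : Type*) [NonUnitalRing R] : LeftModule R R where
  lsmul r s := r * s
  lsmul_add := mul_add
  add_lsmul := add_mul
  mul_lsmul := mul_assoc

instance (R : Type*) [NonUnitalRing R] : RightModule R R where
  rsmul r s := r * s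
  add_rsmul := add_mul
  rsmul_add := mul_add
  rsmul_mul r s t := (mul_assoc r s t).symm

instance (R : Type*) [NonUnitalRing R] : Bimodule R R R where
  lsmul_rsmul := mul_assoc

end Modules

section Tensor

variable (R : Type*) [NonUnitalRing R]

/-- The subgroup of `M ⊗[ℤ] N` generated by the elements `m r ⊗ n - m ⊗ r n`. -/
def balancing (M N : Type*) [AddCommGroup M] [AddCommGroup N] [RightModule R M]
    [LeftModule R N] : AddSubgroup (M ⊗[ℤ] N) :=
  AddSubgroup.closure
    {x | ∃ (m : M) (r : R) (n : N), x = (m •ᵣ r) ⊗ₜ[ℤ] n - m ⊗ₜ[ℤ] (r •ₗ n)}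

/-- The tensor product `M ⊗_R N` of a right module and a left module over a ring that need
neither be commutative nor have a unit. -/
def Tens (M N : Type*) [AddCommGroup M] [AddCommGroup N] [RightModule R M]
    [LeftModule R N] : Type _ :=
  (M ⊗[ℤ] N) ⧸ balancing R M N

namespace Tens

variable {M N P M' N' : Type*} [AddCommGroup M] [AddCommGroup N] [AddCommGroup P]
  [AddCommGroup M'] [AddCommGroup N']
  [RightModule R M] [LeftModule R N] [RightModule R M'] [LeftModule R N']

instance : AddCommGroup (Tens R M N) :=
  inferInstanceAs (AddCommGroup ((M ⊗[ℤ] N) ⧸ balancing R M N))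

/-- The pure tensor `m ⊗_R n`. -/
def tmul (m : M) (n : N) : Tens R M N := QuotientAddGroup.mk' (balancing R M N) (m ⊗ₜ[ℤ] n)

theorem add_tmul (m m' : M) (n : N) : tmul R (m + m') n = tmul R m n + tmul R m' n := by
  unfold tmul; rw [TensorProduct.add_tmul, map_add]; rfl

theorem tmul_add (m : M) (n n' : N) : tmul R m (n + n') = tmul R m n + tmul R m n' := by
  unfold tmul; rw [TensorProduct.tmul_add, map_add]; rfl

theorem rsmul_tmul (m : M) (r : R) (n : N) : tmul R (m •ᵣ r) n = tmul R m (r •ₗ n) := by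
  refine (QuotientAddGroup.eq_iff_sub_mem (N := balancing R M N)).2 ?_
  exact AddSubgroup.subset_closure ⟨m, r, n, rfl⟩

/-- `tmul` as a biadditive map. -/
def mk (M N : Type*) [AddCommGroup M] [AddCommGroup N] [RightModule R M] [LeftModule R N] :
    M →+ N →+ Tens R M N :=
  AddMonoidHom.mk' (fun m => AddMonoidHom.mk' (fun n => tmul R m n) (tmul_add R m))
    (fun m m' => by ext n; exact add_tmul R m m' n)

@[simp] theorem mk_apply (m : M) (n : N) : mk R M N m n = tmul R m n := rfl

/-- The additive map out of `M ⊗_R N` given by an `R`-balanced biadditive map. -/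
def lift (f : M →+ N →+ P) (hf : ∀ m (r : R) n, f (m •ᵣ r) n = f m (r •ₗ n)) :
    Tens R M N →+ P :=
  QuotientAddGroup.lift (balancing R M N)
    (TensorProduct.liftAddHom f (fun z m n => by simp))
    (by
      rw [balancing, AddSubgroup.closure_le]
      rintro _ ⟨m, r, n, rfl⟩
      simp [hf])

@[simp] theorem lift_tmul (f : M →+ N →+ P) (hf : ∀ m (r : R) n, f (m •ᵣ r) n = f m (r •ₗ n))
    (m : M) (n : N) : lift R f hf (tmul R m n) = f m n := rfl

theorem induction {p : Tens R M N → Prop} (h0 : p 0) (ht : ∀ m n, p (tmul R m n))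
    (ha : ∀ x y, p x → p y → p (x + y)) (x : Tens R M N) : p x := by
  obtain ⟨y, rfl⟩ := QuotientAddGroup.mk'_surjective (balancing R M N) x
  induction y using TensorProduct.induction_on with
  | zero => rw [map_zero]; exact h0
  | tmul m n => exact ht m n
  | add a b iha ihb => rw [map_add]; exact ha _ _ iha ihb

theorem hom_ext {f g : Tens R M N →+ P} (h : ∀ m n, f (tmul R m n) = g (tmul R m n)) :
    f = g := by
  ext x
  induction x using induction with
  | h0 => simp
  | ht m n => exact h m n
  | ha x y hx hy => simp [hx, hy]

/-- `f ⊗_R g` for a right linear map `f` and a left linear map `g`. -/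
def map (f : M →+ M') (g : N →+ N') (hf : IsRightLinear R f) (hg : IsLeftLinear R g) :
    Tens R M N →+ Tens R M' N' :=
  lift R (((mk R M' N').comp f).compl₂ g)
    (fun m r n => by
      simp only [AddMonoidHom.compl₂_apply, AddMonoidHom.comp_apply, mk_apply]
      rw [hf, hg, rsmul_tmul])

@[simp] theorem map_tmul (f : M →+ M') (g : N →+ N') (hf : IsRightLinear R f)
    (hg : IsLeftLinear R g) (m : M) (n : N) :
    map R f g hf hg (tmul R m n) = tmul R (f m) (g n) := rfl

end Tens

theorem IsLeftLinear.id {M : Type*} [AddCommGroup M] [LeftModule R M] :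
    IsLeftLinear R (AddMonoidHom.id M) := fun _ _ => rfl

theorem IsRightLinear.id {M : Type*} [AddCommGroup M] [RightModule R M] :
    IsRightLinear R (AddMonoidHom.id M) := fun _ _ => rfl

section Actions

variable {S M N : Type*} [NonUnitalRing S] [AddCommGroup M] [AddCommGroup N]
  [RightModule R M] [LeftModule R N]

theorem lactHom_rightLinear [LeftModule S M] [Bimodule S R M] (s : S) :
    IsRightLinear R (lactHom S M s) := fun m r => (Bimodule.lsmul_rsmul s m r).symm

theorem ractHom_leftLinear [RightModule S N] [Bimodule R S N] (s : S) :
    IsLeftLinear R ((ractHom S N).flip s) := fun r n => Bimodule.lsmul_rsmul r n s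

/-- `s (m ⊗ n) = (s m) ⊗ n`. -/
instance [LeftModule S M] [Bimodule S R M] : LeftModule S (Tens R M N) where
  lsmul s := Tens.map R (lactHom S M s) (AddMonoidHom.id N)
    (lactHom_rightLinear R s) (IsLeftLinear.id R)
  lsmul_add s := map_add _
  add_lsmul s t x := by
    induction x using Tens.induction with
    | h0 => simp only [map_zero, add_zero]
    | ht m n =>
      change Tens.tmul R ((s + t) •ₗ m) n = Tens.tmul R (s •ₗ m) n + Tens.tmul R (t •ₗ m) n
      rw [LeftModule.add_lsmul, Tens.add_tmul]
    | ha x y hx hy => rw [map_add, hx, hy, map_add, map_add, add_add_add_comm]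
  mul_lsmul s t x := by
    induction x using Tens.induction with
    | h0 => simp only [map_zero]
    | ht m n => exact congrArg (fun m => Tens.tmul R m n) (LeftModule.mul_lsmul s t m)
    | ha x y hx hy => rw [map_add, map_add, map_add, hx, hy]

/-- `(m ⊗ n) s = m ⊗ (n s)`. -/
instance [RightModule S N] [Bimodule R S N] : RightModule S (Tens R M N) where
  rsmul x s := Tens.map R (AddMonoidHom.id M) ((ractHom S N).flip s)
    (IsRightLinear.id R) (ractHom_leftLinear R s) x
  add_rsmul x y s := map_add _ x y
  rsmul_add x s t := by
    induction x using Tens.induction with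
    | h0 => simp only [map_zero, add_zero]
    | ht m n =>
      change Tens.tmul R m (n •ᵣ (s + t)) = Tens.tmul R m (n •ᵣ s) + Tens.tmul R m (n •ᵣ t)
      rw [RightModule.rsmul_add, Tens.tmul_add]
    | ha x y hx hy => rw [map_add, hx, hy, map_add, map_add, add_add_add_comm]
  rsmul_mul x s t := by
    induction x using Tens.induction with
    | h0 => simp only [map_zero]
    | ht m n => exact congrArg (Tens.tmul R m) (RightModule.rsmul_mul n s t)
    | ha x y hx hy => rw [map_add, map_add, map_add, hx, hy]

@[simp] theorem Tens.lsmul_tmul [LeftModule S M] [Bimodule S R M] (s : S) (m : M) (n : N) :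
    s •ₗ tmul R m n = tmul R (s •ₗ m) n := rfl

@[simp] theorem Tens.tmul_rsmul [RightModule S N] [Bimodule R S N] (s : S) (m : M) (n : N) :
    tmul R m n •ᵣ s = tmul R m (n •ᵣ s) := rfl

theorem lsmul_zero' (s : S) [LeftModule S M] : s •ₗ (0 : M) = 0 := map_zero (lactHom S M s)

theorem zero_rsmul' (s : S) [RightModule S M] : (0 : M) •ᵣ s = 0 := by
  rw [← ractHom_apply, map_zero]; rfl

instance {T : Type*} [NonUnitalRing T] [LeftModule S M] [Bimodule S R M] [RightModule T N]
    [Bimodule R T N] : Bimodule S T (Tens R M N) where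
  lsmul_rsmul s x t := by
    induction x using Tens.induction with
    | h0 => simp only [lsmul_zero', zero_rsmul']
    | ht m n => rfl
    | ha x y hx hy => simp only [LeftModule.lsmul_add, RightModule.add_rsmul, hx, hy]

end Actions

/-- The map `(m ⊗ n) ⊗ p ↦ m ⊗ (n ⊗ p)`. -/
def Tens.assocHom (A M N P : Type*) [NonUnitalRing A] [AddCommGroup M] [AddCommGroup N]
    [AddCommGroup P] [RightModule A M] [LeftModule A N] [RightModule R N] [Bimodule A R N]
    [LeftModule R P] : Tens R (Tens A M N) P →+ Tens A M (Tens R N P) :=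
  lift R
    (lift A
      (AddMonoidHom.mk' (fun m => AddMonoidHom.mk'
          (fun n => (mk A M (Tens R N P) m).comp (mk R N P n))
          (fun n n' => AddMonoidHom.ext fun p =>
            (congrArg (tmul A m) (add_tmul R n n' p)).trans (tmul_add A m _ _)))
        (fun m m' => AddMonoidHom.ext fun n => AddMonoidHom.ext fun p => add_tmul A m m' _))
      (fun m a n => AddMonoidHom.ext fun p => rsmul_tmul A m a (tmul R n p)))
    (fun x r p => by
      induction x using Tens.induction with
      | h0 => rw [zero_rsmul', map_zero]; rfl
      | ht m n => exact congrArg (tmul A m) (rsmul_tmul R n r p)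
      | ha x y hx hy =>
        rw [RightModule.add_rsmul, map_add, map_add, AddMonoidHom.add_apply,
          AddMonoidHom.add_apply, hx, hy])

/-- The map `m ⊗ (n ⊗ p) ↦ (m ⊗ n) ⊗ p`. -/
def Tens.assocInv (A M N P : Type*) [NonUnitalRing A] [AddCommGroup M] [AddCommGroup N]
    [AddCommGroup P] [RightModule A M] [LeftModule A N] [RightModule R N] [Bimodule A R N]
    [LeftModule R P] : Tens A M (Tens R N P) →+ Tens R (Tens A M N) P :=
  lift A
    (AddMonoidHom.mk' (fun m => lift R ((mk R (Tens A M N) P).comp (mk A M N m))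
        (fun n r p => rsmul_tmul R (tmul A m n) r p))
      (fun m m' => Tens.hom_ext R fun n p =>
        (congrArg (fun x => tmul R x p) (add_tmul A m m' n)).trans (add_tmul R _ _ p)))
    (fun m a x => by
      induction x using Tens.induction with
      | h0 => rw [lsmul_zero', map_zero, map_zero]
      | ht n p => exact congrArg (fun x => tmul R x p) (rsmul_tmul A m a n)
      | ha x y hx hy => rw [LeftModule.lsmul_add, map_add, map_add, hx, hy])

/-- The associativity isomorphism `(M ⊗_A N) ⊗_R P ≅ M ⊗_A (N ⊗_R P)`. -/
def Tens.assoc (A M N P : Type*) [NonUnitalRing A] [AddCommGroup M] [AddCommGroup N]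
    [AddCommGroup P] [RightModule A M] [LeftModule A N] [RightModule R N] [Bimodule A R N]
    [LeftModule R P] : Tens R (Tens A M N) P ≃+ Tens A M (Tens R N P) :=
  AddMonoidHom.toAddEquiv (assocHom R A M N P) (assocInv R A M N P)
    (Tens.hom_ext R (fun x p => by
      induction x using Tens.induction with
      | h0 => simp only [← Tens.mk_apply, map_zero, AddMonoidHom.zero_apply]
      | ht m n => rfl
      | ha x y hx hy => rw [Tens.add_tmul, map_add, map_add, hx, hy]))
    (Tens.hom_ext A (fun m x => by
      induction x using Tens.induction with
      | h0 => simp only [← Tens.mk_apply, map_zero]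
      | ht m n => rfl
      | ha x y hx hy => rw [Tens.tmul_add, map_add, map_add, hx, hy]))

@[simp] theorem Tens.assoc_tmul {A M N P : Type*} [NonUnitalRing A] [AddCommGroup M]
    [AddCommGroup N] [AddCommGroup P] [RightModule A M] [LeftModule A N] [RightModule R N]
    [Bimodule A R N] [LeftModule R P] (m : M) (n : N) (p : P) :
    assoc R A M N P (tmul R (tmul A m n) p) = tmul A m (tmul R n p) := rfl

@[simp] theorem Tens.assoc_symm_tmul {A M N P : Type*} [NonUnitalRing A] [AddCommGroup M]
    [AddCommGroup N] [AddCommGroup P] [RightModule A M] [LeftModule A N] [RightModule R N]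
    [Bimodule A R N] [LeftModule R P] (m : M) (n : N) (p : P) :
    (assoc R A M N P).symm (tmul A m (tmul R n p)) = tmul R (tmul A m n) p := rfl

end Tensor

section Firm

/-- The multiplication map `R ⊗_R M → M`. -/
def lmulMap (R M : Type*) [NonUnitalRing R] [AddCommGroup M] [LeftModule R M] :
    Tens R R M →+ M :=
  Tens.lift R (lactHom R M) (fun s r m => LeftModule.mul_lsmul s r m)

/-- The multiplication map `M ⊗_R R → M`. -/
def rmulMap (R M : Type*) [NonUnitalRing R] [AddCommGroup M] [RightModule R M] :
    Tens R M R →+ M :=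
  Tens.lift R (ractHom R M) (fun m r s => (RightModule.rsmul_mul m r s).symm)

@[simp] theorem lmulMap_tmul {R M : Type*} [NonUnitalRing R] [AddCommGroup M] [LeftModule R M]
    (r : R) (m : M) : lmulMap R M (Tens.tmul R r m) = r •ₗ m := rfl

@[simp] theorem rmulMap_tmul {R M : Type*} [NonUnitalRing R] [AddCommGroup M] [RightModule R M]
    (m : M) (r : R) : rmulMap R M (Tens.tmul R m r) = m •ᵣ r := rfl

/-- Firm left modules. -/
def IsLeftFirm (R M : Type*) [NonUnitalRing R] [AddCommGroup M] [LeftModule R M] : Prop :=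
  Function.Bijective (lmulMap R M)

/-- Firm right modules. -/
def IsRightFirm (R M : Type*) [NonUnitalRing R] [AddCommGroup M] [RightModule R M] : Prop :=
  Function.Bijective (rmulMap R M)

/-- Firm rings: `R` is firm as a right module over itself. -/
def IsFirmRing (R : Type*) [NonUnitalRing R] : Prop := IsRightFirm R R

/-- If `N` is an `R`-`A`-bimodule that is firm over `A`, then so is `M ⊗_R N`. -/
theorem IsRightFirm.tens (R A M N : Type*) [NonUnitalRing R] [NonUnitalRing A] [AddCommGroup M]
    [AddCommGroup N] [RightModule R M] [LeftModule R N] [RightModule A N] [Bimodule R A N]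
    (h : IsRightFirm A N) : IsRightFirm A (Tens R M N) := by
  let e : Tens A N A ≃+ N := AddEquiv.ofBijective (rmulMap A N) h
  have he : IsLeftLinear R e.toAddMonoidHom := by
    intro r x
    induction x using Tens.induction with
    | h0 => rw [lsmul_zero', map_zero, lsmul_zero']
    | ht n a => exact Bimodule.lsmul_rsmul r n a
    | ha x y hx hy => simp only [LeftModule.lsmul_add, map_add, hx, hy]
  have he' : IsLeftLinear R e.symm.toAddMonoidHom := by
    intro r x
    apply e.injective
    have := he r (e.symm x)
    simpa using this.symm
  let f := Tens.map R (AddMonoidHom.id M) e.toAddMonoidHom (IsRightLinear.id R) he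
  let g := Tens.map R (AddMonoidHom.id M) e.symm.toAddMonoidHom (IsRightLinear.id R) he'
  have hgf : g.comp f = AddMonoidHom.id _ := Tens.hom_ext R (fun m n => by simp [f, g])
  have hfg : f.comp g = AddMonoidHom.id _ := Tens.hom_ext R (fun m n => by simp [f, g])
  let k := AddMonoidHom.toAddEquiv f g hgf hfg
  have : rmulMap A (Tens R M N) = f.comp (Tens.assoc A R M N A).toAddMonoidHom :=
    Tens.hom_ext A (fun x a => by
      induction x using Tens.induction with
      | h0 => simp only [← Tens.mk_apply, map_zero, AddMonoidHom.zero_apply]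
      | ht m n => rfl
      | ha x y hx hy => simp only [Tens.add_tmul, map_add, hx, hy])
  unfold IsRightFirm
  rw [this]
  exact k.bijective.comp (Tens.assoc A R M N A).bijective

end Firm

section Bimodules

/-- Firm `R`-`A`-bimodules: bimodules that are firm on the left over `R` and firm on the right
over `A`. -/
structure FirmBimodule (R A : Type u) [NonUnitalRing R] [NonUnitalRing A] where
  carrier : Type u
  [addCommGroup : AddCommGroup carrier]
  [leftModule : LeftModule R carrier]
  [rightModule : RightModule A carrier]
  [bimodule : Bimodule R A carrier]
  leftFirm : IsLeftFirm R carrier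
  rightFirm : IsRightFirm A carrier

attribute [instance] FirmBimodule.addCommGroup FirmBimodule.leftModule
  FirmBimodule.rightModule FirmBimodule.bimodule

instance (R A : Type u) [NonUnitalRing R] [NonUnitalRing A] :
    CoeSort (FirmBimodule R A) (Type u) := ⟨FirmBimodule.carrier⟩

/-- Additive maps that respect the left `R`-action and the right `A`-action. -/
def IsBilinear (R A : Type*) {M N : Type*} [NonUnitalRing R] [NonUnitalRing A] [AddCommGroup M]
    [AddCommGroup N] [LeftModule R M] [LeftModule R N] [RightModule A M] [RightModule A N]
    (f : M →+ N) : Prop :=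
  IsLeftLinear R f ∧ IsRightLinear A f

/-- Bimodules `M` and `N` are isomorphic. -/
def BimoduleIso (R A M N : Type*) [NonUnitalRing R] [NonUnitalRing A] [AddCommGroup M]
    [AddCommGroup N] [LeftModule R M] [LeftModule R N] [RightModule A M] [RightModule A N] :
    Prop :=
  ∃ e : M ≃+ N, IsBilinear R A e.toAddMonoidHom

end Bimodules

section Dual

variable (A M : Type*) [NonUnitalRing A] [AddCommGroup M] [RightModule A M]

/-- The dual `M* = Hom_A(M, A)` of a right `A`-module: the right `A`-linear maps `M → A`. -/
def Dual : AddSubgroup (M →+ A) where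
  carrier := {f | IsRightLinear A f}
  zero_mem' := fun _ a => (zero_mul a).symm
  add_mem' := fun {f g} hf hg m a => by
    rw [AddMonoidHom.add_apply, AddMonoidHom.add_apply, hf, hg, RightModule.add_rsmul]
  neg_mem' := fun {f} hf m a => by
    rw [AddMonoidHom.neg_apply, AddMonoidHom.neg_apply, hf]
    exact (neg_mul (f m) a).symm

variable {A M}

/-- `(a φ)(m) = a φ(m)`. -/
instance : LeftModule A (Dual A M) where
  lsmul a φ := ⟨(AddMonoidHom.mulLeft a).comp φ.1, fun m b => by
    rw [AddMonoidHom.comp_apply, φ.2]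
    exact (mul_assoc a (φ.1 m) b).symm⟩
  lsmul_add a φ ψ := by ext m; exact mul_add a (φ.1 m) (ψ.1 m)
  add_lsmul a b φ := by ext m; exact add_mul a b (φ.1 m)
  mul_lsmul a b φ := by ext m; exact mul_assoc a b (φ.1 m)

/-- `(φ r)(m) = φ(r m)`. -/
instance {R : Type*} [NonUnitalRing R] [LeftModule R M] [Bimodule R A M] :
    RightModule R (Dual A M) where
  rsmul φ r := ⟨φ.1.comp (lactHom R M r), fun m a => by
    rw [AddMonoidHom.comp_apply, AddMonoidHom.comp_apply, lactHom_apply, lactHom_apply,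
      ← Bimodule.lsmul_rsmul, φ.2]⟩
  add_rsmul φ ψ r := rfl
  rsmul_add φ r s := by
    ext m
    change φ.1 ((r + s) •ₗ m) = φ.1 (r •ₗ m) + φ.1 (s •ₗ m)
    rw [LeftModule.add_lsmul, map_add]
  rsmul_mul φ r s := by
    ext m
    exact congrArg φ.1 (LeftModule.mul_lsmul r s m)

instance {R : Type*} [NonUnitalRing R] [LeftModule R M] [Bimodule R A M] :
    Bimodule A R (Dual A M) where
  lsmul_rsmul _ _ _ := rfl

variable (A M)

/-- The elementary ring `Z = M ⊗_A M*`. -/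
def ElementaryRing : Type _ := Tens A M (Dual A M)

namespace ElementaryRing

instance : AddCommGroup (ElementaryRing A M) := inferInstanceAs (AddCommGroup (Tens A M _))

variable {A M} in
/-- The element `u ⊗ φ` of `Z`. -/
def tmul (u : M) (φ : Dual A M) : ElementaryRing A M := Tens.tmul A u φ

variable {A M} in
theorem induction {p : ElementaryRing A M → Prop} (h0 : p 0) (ht : ∀ u φ, p (tmul u φ))
    (ha : ∀ x y, p x → p y → p (x + y)) (x : ElementaryRing A M) : p x :=
  Tens.induction A h0 ht ha x

/-- The action of `Z` on `M`: `(u ⊗ φ) v = u φ(v)`. -/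
def act : ElementaryRing A M →+ M →+ M :=
  Tens.lift A
    (AddMonoidHom.mk' (fun u => AddMonoidHom.mk' (fun φ : Dual A M => (ractHom A M u).comp φ.1)
        (fun φ ψ => by ext v; exact RightModule.rsmul_add u (φ.1 v) (ψ.1 v)))
      (fun u u' => by ext φ v; exact RightModule.add_rsmul u u' (φ.1 v)))
    (fun u a φ => by ext v; exact (RightModule.rsmul_mul u a (φ.1 v)).symm)

theorem act_tmul (u : M) (φ : Dual A M) (v : M) : act A M (tmul u φ) v = u •ᵣ φ.1 v := rfl

theorem act_rightLinear (z : ElementaryRing A M) : IsRightLinear A (act A M z) := by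
  intro v a
  induction z using induction with
  | h0 => exact (zero_rsmul' a).symm
  | ht u φ =>
    rw [act_tmul, act_tmul, φ.2]
    exact RightModule.rsmul_mul u (φ.1 v) a
  | ha x y hx hy =>
    rw [map_add, AddMonoidHom.add_apply, AddMonoidHom.add_apply, RightModule.add_rsmul, hx, hy]

/-- Left multiplication by `z`, that is, `z (v ⊗ ψ) = (z v) ⊗ ψ`; in particular
`(u ⊗ φ) (v ⊗ ψ) = u φ(v) ⊗ ψ`. -/
def mulLeft (z : ElementaryRing A M) : ElementaryRing A M →+ ElementaryRing A M :=
  Tens.map A (act A M z) (AddMonoidHom.id _) (act_rightLinear A M z) (IsLeftLinear.id A)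

theorem mulLeft_tmul (z : ElementaryRing A M) (v : M) (ψ : Dual A M) :
    mulLeft A M z (tmul v ψ) = tmul (act A M z v) ψ := rfl

theorem mulLeft_add (z w x : ElementaryRing A M) :
    mulLeft A M (z + w) x = mulLeft A M z x + mulLeft A M w x := by
  induction x using induction with
  | h0 => simp
  | ht v ψ =>
    rw [mulLeft_tmul, mulLeft_tmul, mulLeft_tmul, map_add]
    exact Tens.add_tmul A _ _ ψ
  | ha x y hx hy => rw [map_add, map_add, map_add, hx, hy, add_add_add_comm]

theorem act_mulLeft (z w : ElementaryRing A M) (v : M) :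
    act A M (mulLeft A M z w) v = act A M z (act A M w v) := by
  induction w using induction with
  | h0 => simp
  | ht u φ =>
    rw [mulLeft_tmul, act_tmul, act_tmul]
    exact (act_rightLinear A M z u (φ.1 v)).symm
  | ha x y hx hy =>
    rw [map_add, map_add, map_add, AddMonoidHom.add_apply, AddMonoidHom.add_apply, map_add, hx, hy]

instance : NonUnitalRing (ElementaryRing A M) :=
  { (inferInstance : AddCommGroup (ElementaryRing A M)) with
    mul := fun z w => mulLeft A M z w
    left_distrib := fun z => map_add (mulLeft A M z)
    right_distrib := mulLeft_add A M
    zero_mul := fun x => by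
      change mulLeft A M 0 x = 0
      simpa using mulLeft_add A M 0 0 x
    mul_zero := fun z => map_zero (mulLeft A M z)
    mul_assoc := fun z w x => by
      change mulLeft A M (mulLeft A M z w) x = mulLeft A M z (mulLeft A M w x)
      induction x using induction with
      | h0 => simp
      | ht u φ => rw [mulLeft_tmul, mulLeft_tmul, mulLeft_tmul, act_mulLeft]
      | ha x y hx hy => rw [map_add, map_add, map_add, hx, hy] }

instance : LeftModule (ElementaryRing A M) M where
  lsmul z v := act A M z v
  lsmul_add z := map_add (act A M z)
  add_lsmul z w v := by rw [map_add]; rfl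
  mul_lsmul z w v := act_mulLeft A M z w v

end ElementaryRing

/-- `R`-firm projectivity of an `R`-`A`-bimodule `M`: there is a ring morphism
`ι : R → Z = M ⊗_A M*` that induces the left `R`-module structure of `M`, and `M` is firm as a left
`R`-module under this structure. -/
def IsFirmlyProjective (R : Type*) [NonUnitalRing R] [LeftModule R M] [Bimodule R A M] : Prop :=
  ∃ ι : R →ₙ+* ElementaryRing A M, (∀ (r : R) (u : M), r •ₗ u = ι r •ₗ u) ∧ IsLeftFirm R M

end Dual

section Context

/-- Comatrix coring contexts `(R, A, S, T, η, ε)`. The two commutative diagrams are written with the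
multiplication isomorphisms `R ⊗_R S ≅ S`, `S ⊗_A A ≅ S`, `T ⊗_R R ≅ T` and `A ⊗_A T ≅ T` instead of
their inverses. -/
structure ComatrixCoringContext (R A : Type u) [NonUnitalRing R] [NonUnitalRing A]
    (S : FirmBimodule R A) (T : FirmBimodule A R) where
  η : R →+ Tens A S T
  ε : Tens R T S →+ A
  η_bilinear : IsBilinear R R η
  ε_bilinear : IsBilinear A A ε
  left_comm : ∀ x : Tens R R S,
    rmulMap A S
      (Tens.map A (AddMonoidHom.id S) ε (IsRightLinear.id A) ε_bilinear.1
        (Tens.assoc R A S T S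
          (Tens.map R η (AddMonoidHom.id S) η_bilinear.2 (IsLeftLinear.id R) x))) =
    lmulMap R S x
  right_comm : ∀ x : Tens R T R,
    lmulMap A T
      (Tens.map A ε (AddMonoidHom.id T) ε_bilinear.2 (IsLeftLinear.id A)
        ((Tens.assoc A R T S T).symm
          (Tens.map R (AddMonoidHom.id T) η (IsRightLinear.id R) η_bilinear.1 x))) =
    rmulMap R T x

end Context

section Categories

/-- The objects of the category of firm right `R`-modules. -/
structure FirmMod (R : Type u) [NonUnitalRing R] where
  carrier : Type u
  [addCommGroup : AddCommGroup carrier]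
  [rightModule : RightModule R carrier]
  firm : IsRightFirm R carrier

attribute [instance] FirmMod.addCommGroup FirmMod.rightModule

namespace FirmMod

instance (R : Type u) [NonUnitalRing R] : CoeSort (FirmMod R) (Type u) := ⟨FirmMod.carrier⟩

/-- Morphisms of firm right modules: the right linear maps. -/
@[ext]
structure Hom {R : Type u} [NonUnitalRing R] (M N : FirmMod R) where
  hom : M →+ N
  linear : IsRightLinear R hom

instance (R : Type u) [NonUnitalRing R] : Category (FirmMod R) where
  Hom M N := Hom M N
  id M := ⟨AddMonoidHom.id M, IsRightLinear.id R⟩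
  comp f g := ⟨g.hom.comp f.hom, fun m r => by
    rw [AddMonoidHom.comp_apply, f.linear, g.linear]; rfl⟩

/-- A firm ring as a firm right module over itself. -/
def self (R : Type u) [NonUnitalRing R] (hR : IsFirmRing R) : FirmMod R := ⟨R, hR⟩

/-- Left multiplication by `r`, as an endomorphism of the right module `R`. -/
def mulLeft {R : Type u} [NonUnitalRing R] (hR : IsFirmRing R) (r : R) : self R hR ⟶ self R hR :=
  Hom.mk (M := self R hR) (N := self R hR) (AddMonoidHom.mulLeft r)
    (fun m s => (mul_assoc r m s).symm)

/-- The functor `- ⊗_R S` from firm right `R`-modules to firm right `A`-modules. -/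
def tensFunctor {R A : Type u} [NonUnitalRing R] [NonUnitalRing A] (S : FirmBimodule R A) :
    FirmMod R ⥤ FirmMod A where
  obj M := ⟨Tens R M S, IsRightFirm.tens R A M S S.rightFirm⟩
  map f := Hom.mk (Tens.map R f.hom (AddMonoidHom.id S) f.linear (IsLeftLinear.id R))
    (fun x a => by
      induction x using Tens.induction with
      | h0 => rw [zero_rsmul', map_zero, zero_rsmul']
      | ht m n => rfl
      | ha x y hx hy => rw [RightModule.add_rsmul, map_add, map_add, RightModule.add_rsmul, hx, hy])
  map_id M := Hom.ext (Tens.hom_ext R (fun _ _ => rfl))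
  map_comp f g := Hom.ext (Tens.hom_ext R (fun _ _ => rfl))

end FirmMod

/-- `F(R)` is isomorphic to `S` as an `R`-`A`-bimodule, where `r ∈ R` acts from the left on `F(R)` as
the image under `F` of the left multiplication by `r`. -/
def ValueAtRingIso {R A : Type u} [NonUnitalRing R] [NonUnitalRing A] (hR : IsFirmRing R)
    (F : FirmMod R ⥤ FirmMod A) (S : FirmBimodule R A) : Prop :=
  ∃ e : F.obj (FirmMod.self R hR) ≃+ S,
    IsRightLinear A e.toAddMonoidHom ∧
    ∀ (r : R) (x : F.obj (FirmMod.self R hR)),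
      e ((F.map (FirmMod.mulLeft hR r)).hom x) = r •ₗ e x

/-- There is a triple `(F, G, H)` of adjoint functors between the categories of firm right modules
over `R` and over `A` such that `F(R) = S`. -/
def HasAdjointTriple {R A : Type u} [NonUnitalRing R] [NonUnitalRing A] (hR : IsFirmRing R)
    (S : FirmBimodule R A) : Prop :=
  ∃ (F : FirmMod R ⥤ FirmMod A) (G : FirmMod A ⥤ FirmMod R) (H : FirmMod R ⥤ FirmMod A),
    Nonempty (F ⊣ G) ∧ Nonempty (G ⊣ H) ∧ ValueAtRingIso hR F S

end Categories

end FirmRings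

open FirmRings

/-! A firm module `M ≅ M ⊗_R R` makes up for the missing unit. An additive map out of `M` is
determined by its values on products `m r`, and any biadditive `b` with `b(m r, s) = b(m, r s)`
defines one (`IsRightFirm.hom_ext`, `IsRightFirm.lift`). So whatever one would normally define at
`1` is defined on products instead.

Firm projectivity is a dual basis that depends on `r`. If `ι(r) = Σ uᵢ ⊗ φᵢ`, then `r u = Σ uᵢ
φᵢ(u)` for all `u` and `φ r = Σ φ(uᵢ) φᵢ` for all `φ` in `S*`. With `T = S* ⊗_R R`, the coevaluation
sends `r s` to `Σ uᵢ ⊗ (φᵢ ⊗ s)`, the evaluation is `(φ ⊗ s) ⊗ u ↦ φ(s u)`, and both triangle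
identities reduce to these two formulas (`nonempty_context_of_iso`). The same formulas show that `T`
is firm over `A` (`isLeftFirm_dual_tens`). Conversely, a context gives `T → S*`, `t ↦ ε(t ⊗ -)`.
Composing with `η` yields `ι`, and the triangle identities force `T ≅ S* ⊗_R R`
(`ComatrixCoringContext.isFirmlyProjective`, `ComatrixCoringContext.bimoduleIso`).

A context is the same as an adjunction of tensor functors: `η` and `ε` induce unit and counit, and
these are recovered from their components at `R` and `A` by naturality along the maps `r ↦ m r` and
`a ↦ n a` (`ComatrixCoringContext.adjunction`, `FirmMod.contextOfAdjunction`).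

Finally, `- ⊗_A T` always has the right adjoint `Hom_R(T, -) ⊗_A A`, which completes an adjoint
triple. In the other direction an Eilenberg-Watts theorem (`FirmMod.isIso_watts`) identifies any
left adjoint `F` with `- ⊗_R F(R)`; in a triple it applies to both `F` and `G`. -/

namespace FirmRings

/-! ### Maps out of firm modules. -/

section Basics

theorem rsmul_zero' {R M : Type*} [NonUnitalRing R] [AddCommGroup M] [RightModule R M] (m : M) :
    m •ᵣ (0 : R) = 0 := map_zero (ractHom R M m)

theorem zero_lsmul' {R M : Type*} [NonUnitalRing R] [AddCommGroup M] [LeftModule R M] (m : M) :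
    (0 : R) •ₗ m = 0 :=
  DFunLike.congr_fun (map_zero (lactHom R M)) m

theorem Tens.zero_tmul (R : Type*) {M N : Type*} [NonUnitalRing R] [AddCommGroup M]
    [AddCommGroup N] [RightModule R M] [LeftModule R N] (n : N) : tmul R (0 : M) n = 0 :=
  DFunLike.congr_fun (map_zero (mk R M N)) n

theorem Tens.tmul_zero (R : Type*) {M N : Type*} [NonUnitalRing R] [AddCommGroup M]
    [AddCommGroup N] [RightModule R M] [LeftModule R N] (m : M) : tmul R m (0 : N) = 0 :=
  map_zero (mk R M N m)

theorem rmulMap_rightLinear (R M : Type*) [NonUnitalRing R] [AddCommGroup M] [RightModule R M] :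
    IsRightLinear R (rmulMap R M) := by
  intro x r
  induction x using Tens.induction with
  | h0 => rw [zero_rsmul', map_zero, zero_rsmul']
  | ht m s => exact RightModule.rsmul_mul m s r
  | ha x y hx hy => rw [RightModule.add_rsmul, map_add, map_add, hx, hy, RightModule.add_rsmul]

theorem rmulMap_leftLinear (R A M : Type*) [NonUnitalRing R] [NonUnitalRing A] [AddCommGroup M]
    [LeftModule R M] [RightModule A M] [Bimodule R A M] : IsLeftLinear R (rmulMap A M) := by
  intro r x
  induction x using Tens.induction with
  | h0 => rw [lsmul_zero', map_zero, lsmul_zero']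
  | ht m a => exact Bimodule.lsmul_rsmul r m a
  | ha x y hx hy => rw [LeftModule.lsmul_add, map_add, map_add, hx, hy, LeftModule.lsmul_add]

/-- In `M ⊗_R R`, acting by `r` is tensoring the product with `r`. -/
theorem Tens.rsmul_eq_rmulMap_tmul {R M : Type*} [NonUnitalRing R] [AddCommGroup M]
    [RightModule R M] (x : Tens R M R) (r : R) : x •ᵣ r = tmul R (rmulMap R M x) r := by
  induction x using Tens.induction with
  | h0 => rw [zero_rsmul', map_zero, zero_tmul]
  | ht m s => exact (rsmul_tmul R m s r).symm
  | ha x y hx hy => rw [RightModule.add_rsmul, map_add, hx, hy, add_tmul]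

namespace IsRightFirm

variable {R M P : Type*} [NonUnitalRing R] [AddCommGroup M] [AddCommGroup P] [RightModule R M]

/-- Surjectivity of the multiplication map: every element of a firm module is a finite sum of
products `m r`. -/
theorem induction (h : IsRightFirm R M) {p : M → Prop} (h0 : p 0) (hs : ∀ m (r : R), p (m •ᵣ r))
    (ha : ∀ x y, p x → p y → p (x + y)) (x : M) : p x := by
  obtain ⟨y, rfl⟩ := h.2 x
  induction y using Tens.induction with
  | h0 => rwa [map_zero]
  | ht m r => exact hs m r
  | ha x y hx hy => rw [map_add]; exact ha _ _ hx hy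

theorem hom_ext (h : IsRightFirm R M) {f g : M →+ P} (hfg : ∀ m (r : R), f (m •ᵣ r) = g (m •ᵣ r)) :
    f = g := by
  ext x
  induction x using h.induction with
  | h0 => rw [map_zero, map_zero]
  | hs m r => exact hfg m r
  | ha x y hx hy => rw [map_add, map_add, hx, hy]

/-- The additive map `m r ↦ f m r` out of a firm module. -/
noncomputable def lift (h : IsRightFirm R M) (f : M →+ R →+ P)
    (hf : ∀ m (r s : R), f (m •ᵣ r) s = f m (r * s)) : M →+ P :=
  (Tens.lift R f hf).comp (AddEquiv.ofBijective (rmulMap R M) h).symm.toAddMonoidHom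

@[simp] theorem lift_rsmul (h : IsRightFirm R M) (f : M →+ R →+ P)
    (hf : ∀ m (r s : R), f (m •ᵣ r) s = f m (r * s)) (m : M) (r : R) :
    h.lift f hf (m •ᵣ r) = f m r := by
  have : (AddEquiv.ofBijective (rmulMap R M) h).symm (m •ᵣ r) = Tens.tmul R m r :=
    (AddEquiv.symm_apply_eq _).2 rfl
  change Tens.lift R f hf ((AddEquiv.ofBijective (rmulMap R M) h).symm (m •ᵣ r)) = _
  rw [this, Tens.lift_tmul]

end IsRightFirm

theorem IsFirmRing.firm {R : Type*} [NonUnitalRing R] (h : IsFirmRing R) : IsRightFirm R R := h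

theorem IsLeftFirm.induction {R M : Type*} [NonUnitalRing R] [AddCommGroup M] [LeftModule R M]
    (h : IsLeftFirm R M) {p : M → Prop} (h0 : p 0) (hs : ∀ (r : R) m, p (r •ₗ m))
    (ha : ∀ x y, p x → p y → p (x + y)) (x : M) : p x := by
  obtain ⟨y, rfl⟩ := h.2 x
  induction y using Tens.induction with
  | h0 => rwa [map_zero]
  | ht r m => exact hs r m
  | ha x y hx hy => rw [map_add]; exact ha _ _ hx hy

end Basics

/-! ### Contractions of `S ⊗_A T`. -/

section Contraction

variable {R A S T : Type*} [NonUnitalRing R] [NonUnitalRing A] [AddCommGroup S] [AddCommGroup T]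
  [RightModule A S] [LeftModule A T]

theorem Dual.linear (φ : Dual A S) : IsRightLinear A φ.1 := φ.2

/-- The map `u ⊗ t ↦ u g(t)`. -/
def contractRight (S : Type*) [AddCommGroup S] [RightModule A S] (g : T →+ A)
    (hg : IsLeftLinear A g) : Tens A S T →+ S :=
  (rmulMap A S).comp (Tens.map A (AddMonoidHom.id S) g (IsRightLinear.id A) hg)

/-- The map `u ⊗ t ↦ f(u) t`. -/
def contractLeft (T : Type*) [AddCommGroup T] [LeftModule A T] (f : S →+ A)
    (hf : IsRightLinear A f) : Tens A S T →+ T :=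
  (lmulMap A T).comp (Tens.map A f (AddMonoidHom.id T) hf (IsLeftLinear.id A))

theorem contractLeft_rightLinear [RightModule R T] [Bimodule A R T] (f : S →+ A)
    (hf : IsRightLinear A f) : IsRightLinear R (contractLeft T f hf) := by
  intro x r
  induction x using Tens.induction with
  | h0 => rw [zero_rsmul', map_zero, zero_rsmul']
  | ht u t => exact (Bimodule.lsmul_rsmul (f u) t r).symm
  | ha x y hx hy => rw [RightModule.add_rsmul, map_add, map_add, hx, hy, RightModule.add_rsmul]

theorem contractLeft_lsmul [LeftModule R S] [Bimodule R A S] (φ : Dual A S) (r : R)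
    (x : Tens A S T) :
    contractLeft T φ.1 (Dual.linear φ) (r •ₗ x) =
      contractLeft T (φ •ᵣ r).1 (Dual.linear (φ •ᵣ r)) x := by
  induction x using Tens.induction with
  | h0 => rw [lsmul_zero', map_zero, map_zero]
  | ht u t => rfl
  | ha x y hx hy => rw [LeftModule.lsmul_add, map_add, map_add, hx, hy]

theorem contractLeft_add (φ ψ : Dual A S) (x : Tens A S T) :
    contractLeft T (φ + ψ).1 (Dual.linear (φ + ψ)) x =
      contractLeft T φ.1 (Dual.linear φ) x + contractLeft T ψ.1 (Dual.linear ψ) x := by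
  induction x using Tens.induction with
  | h0 => simp only [map_zero, add_zero]
  | ht u t => exact LeftModule.add_lsmul (φ.1 u) (ψ.1 u) t
  | ha x y hx hy => rw [map_add, hx, hy, map_add, map_add, add_add_add_comm]

/-- On `u ⊗ t` both sides are `f(u) g(t)`. This is what lets a triangle identity for `S` be read off
after applying a functional. -/
theorem map_contractLeft (f : S →+ A) (hf : IsRightLinear A f) (g : T →+ A)
    (hg : IsLeftLinear A g) (x : Tens A S T) :
    g (contractLeft T f hf x) = f (contractRight S g hg x) := by
  induction x using Tens.induction with
  | h0 => simp only [map_zero]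
  | ht u t => exact (hg (f u) t).trans (hf u (g t)).symm
  | ha x y hx hy => simp only [map_add, hx, hy]

/-- Contracting `x` in `Z` with `f` gives the functional `f ∘ x`, so it depends on `x` only through
its action on `S`. -/
theorem contractLeft_dual_apply (f : S →+ A) (hf : IsRightLinear A f)
    (x : ElementaryRing A S) (u : S) :
    (contractLeft (Dual A S) f hf x).1 u = f (ElementaryRing.act A S x u) := by
  induction x using ElementaryRing.induction with
  | h0 =>
    exact (congrArg (fun φ : Dual A S => φ.1 u) (map_zero (contractLeft (Dual A S) f hf))).trans
      ((map_zero f).symm.trans (congrArg (fun g : S →+ S => f (g u))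
        (map_zero (ElementaryRing.act A S)).symm))
  | ht v φ => exact (hf v (φ.1 u)).symm
  | ha x y hx hy =>
    rw [map_add, AddMonoidHom.add_apply, map_add f, ← hx, ← hy, ← AddMonoidHom.add_apply]
    exact congrArg (fun φ : Dual A S => φ.1 u) (map_add (contractLeft (Dual A S) f hf) x y)

end Contraction

/-! ### The triangle identities in terms of elements. -/

section Context

variable {R A : Type u} [NonUnitalRing R] [NonUnitalRing A] {S : FirmBimodule R A}
  {T : FirmBimodule A R}

/-- For an evaluation map `ε`, the map `ε(- ⊗ u)`. -/
def evalAt (ε : Tens R T S →+ A) (u : S) : T →+ A := ε.comp ((Tens.mk R T S).flip u)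

/-- For an evaluation map `ε`, the map `ε(t ⊗ -)`. -/
def evalBy (ε : Tens R T S →+ A) (t : T) : S →+ A := ε.comp (Tens.mk R T S t)

theorem evalAt_leftLinear {ε : Tens R T S →+ A} (h : IsBilinear A A ε) (u : S) :
    IsLeftLinear A (evalAt ε u) := fun a t => h.1 a (Tens.tmul R t u)

theorem evalBy_rightLinear {ε : Tens R T S →+ A} (h : IsBilinear A A ε) (t : T) :
    IsRightLinear A (evalBy ε t) := fun u a => h.2 (Tens.tmul R t u) a

theorem contractRight_evalAt {ε : Tens R T S →+ A} (h : IsBilinear A A ε) (u : S)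
    (x : Tens A S T) :
    rmulMap A S (Tens.map A (AddMonoidHom.id S) ε (IsRightLinear.id A) h.1
      (Tens.assoc R A S T S (Tens.tmul R x u))) =
    contractRight S (evalAt ε u) (evalAt_leftLinear h u) x := by
  induction x using Tens.induction with
  | h0 => simp only [Tens.zero_tmul, map_zero]
  | ht v t => rfl
  | ha x y hx hy => rw [Tens.add_tmul, map_add, map_add, map_add, map_add, hx, hy]

theorem contractLeft_evalBy {ε : Tens R T S →+ A} (h : IsBilinear A A ε) (t : T)
    (x : Tens A S T) :
    lmulMap A T (Tens.map A ε (AddMonoidHom.id T) h.2 (IsLeftLinear.id A)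
      ((Tens.assoc A R T S T).symm (Tens.tmul R t x))) =
    contractLeft T (evalBy ε t) (evalBy_rightLinear h t) x := by
  induction x using Tens.induction with
  | h0 => simp only [Tens.tmul_zero, map_zero]
  | ht v t => rfl
  | ha x y hx hy => rw [Tens.tmul_add, map_add, map_add, map_add, map_add, hx, hy]

/-- A comatrix coring context from the elementwise form of the two identities. -/
def ComatrixCoringContext.ofElements (η : R →+ Tens A S T) (ε : Tens R T S →+ A)
    (hη : IsBilinear R R η) (hε : IsBilinear A A ε)
    (hl : ∀ r u, contractRight S (evalAt ε u) (evalAt_leftLinear hε u) (η r) = r •ₗ u)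
    (hr : ∀ t r, contractLeft T (evalBy ε t) (evalBy_rightLinear hε t) (η r) = t •ᵣ r) :
    ComatrixCoringContext R A S T where
  η := η
  ε := ε
  η_bilinear := hη
  ε_bilinear := hε
  left_comm x := by
    induction x using Tens.induction with
    | h0 => simp only [map_zero]
    | ht r u => exact (contractRight_evalAt hε u (η r)).trans (hl r u)
    | ha x y hx hy => simp only [map_add, hx, hy]
  right_comm x := by
    induction x using Tens.induction with
    | h0 => simp only [map_zero]
    | ht t r => exact (contractLeft_evalBy hε t (η r)).trans (hr t r)
    | ha x y hx hy => simp only [map_add, hx, hy]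

namespace ComatrixCoringContext

variable (c : ComatrixCoringContext R A S T)

theorem contractRight_η (r : R) (u : S) :
    contractRight S (evalAt c.ε u) (evalAt_leftLinear c.ε_bilinear u) (c.η r) = r •ₗ u :=
  (contractRight_evalAt c.ε_bilinear u (c.η r)).symm.trans (c.left_comm (Tens.tmul R r u))

theorem contractLeft_η (t : T) (r : R) :
    contractLeft T (evalBy c.ε t) (evalBy_rightLinear c.ε_bilinear t) (c.η r) = t •ᵣ r :=
  (contractLeft_evalBy c.ε_bilinear t (c.η r)).symm.trans (c.right_comm (Tens.tmul R t r))

end ComatrixCoringContext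

end Context

/-! ### Firm projectivity and left firmness of `S* ⊗_R R`. -/

section FirmlyProjective

variable {R A S : Type*} [NonUnitalRing R] [NonUnitalRing A] [AddCommGroup S] [LeftModule R S]
  [RightModule A S] [Bimodule R A S]

/-- Left multiplication by `z` only uses the action of `z` on the first factor, so it cannot
distinguish `z` from `r`. -/
theorem ElementaryRing.mul_eq_lsmul {z : ElementaryRing A S} {r : R}
    (h : ∀ u : S, ElementaryRing.act A S z u = r •ₗ u) (x : Tens A S (Dual A S)) :
    ElementaryRing.mulLeft A S z x = r •ₗ x := by
  refine DFunLike.congr_fun (Tens.hom_ext A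
    (f := (ElementaryRing.mulLeft A S z : Tens A S (Dual A S) →+ Tens A S (Dual A S)))
    (g := lactHom R (Tens A S (Dual A S)) r) fun u φ => ?_) x
  exact congrArg (fun v => Tens.tmul A v φ) (h u)

/-- Moving scalars across the tensor sign gives `(u ⊗ φ) z = u ⊗ (φ ∘ z)`, and `φ ∘ z = φ r` as
functionals. Together with `ElementaryRing.mul_eq_lsmul` this makes a ring morphism `ι` inducing the
action automatically `R`-bilinear. -/
theorem ElementaryRing.mul_eq_rsmul {z : ElementaryRing A S} {r : R}
    (h : ∀ u : S, ElementaryRing.act A S z u = r •ₗ u) (x : Tens A S (Dual A S)) :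
    ElementaryRing.mulLeft A S x z = x •ᵣ r := by
  induction x using Tens.induction with
  | h0 => exact (zero_mul z).trans (zero_rsmul' (M := Tens A S (Dual A S)) r).symm
  | ht u φ =>
    have key : ∀ w : Tens A S (Dual A S), ElementaryRing.mulLeft A S (ElementaryRing.tmul u φ) w =
        Tens.tmul A u (contractLeft (Dual A S) φ.1 (Dual.linear φ) w) := fun w =>
      DFunLike.congr_fun (Tens.hom_ext A
        (f := (ElementaryRing.mulLeft A S (ElementaryRing.tmul u φ) :
          Tens A S (Dual A S) →+ Tens A S (Dual A S)))
        (g := (Tens.mk A S (Dual A S) u).comp (contractLeft (Dual A S) φ.1 (Dual.linear φ)))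
        fun v ψ => Tens.rsmul_tmul A u (φ.1 v) ψ) w
    refine (key z).trans (congrArg (Tens.tmul A u) (Subtype.ext (AddMonoidHom.ext fun v => ?_)))
    exact (contractLeft_dual_apply φ.1 (Dual.linear φ) z v).trans (congrArg φ.1 (h v))
  | ha x y hx hy =>
    rw [RightModule.add_rsmul, ← hx, ← hy]
    exact ElementaryRing.mulLeft_add A S x y z

section

variable (ι : R →ₙ+* ElementaryRing A S) (hι : ∀ (r : R) (u : S), r •ₗ u = ι r •ₗ u)

/-- A ring morphism `R → S ⊗_A S*` as an additive map. -/
def toTens : R →+ Tens A S (Dual A S) := AddMonoidHom.mk' (fun r => ι r) (map_add ι)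

include hι

theorem toTens_leftLinear : IsLeftLinear R (toTens ι) := fun r s =>
  (map_mul ι r s).trans (ElementaryRing.mul_eq_lsmul (fun u => (hι r u).symm) (ι s))

theorem toTens_rightLinear : IsRightLinear R (toTens ι) := fun s r =>
  (map_mul ι s r).trans (ElementaryRing.mul_eq_rsmul (fun u => (hι r u).symm) (ι s))

/-- The dual half of the dual basis property: `φ r = Σ φ(uᵢ) φᵢ` when `ι(r) = Σ uᵢ ⊗ φᵢ`. -/
theorem contractLeft_toTens (φ : Dual A S) (r : R) :
    contractLeft (Dual A S) φ.1 (Dual.linear φ) (toTens ι r) = φ •ᵣ r := by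
  refine Subtype.ext (AddMonoidHom.ext fun u => ?_)
  exact (contractLeft_dual_apply φ.1 (Dual.linear φ) _ u).trans (congrArg φ.1 (hι r u).symm)

end

/-- The map `(u ⊗ ψ) ↦ φ(u) ⊗ (ψ ⊗ s)`. -/
def evalTens (R : Type*) [NonUnitalRing R] [LeftModule R S] [Bimodule R A S] (φ : Dual A S)
    (s : R) : Tens A S (Dual A S) →+ Tens A A (Tens R (Dual A S) R) :=
  Tens.map A φ.1 ((Tens.mk R (Dual A S) R).flip s) (Dual.linear φ) (fun _ _ => rfl)

/-- This identity and the next ones make `φ ⊗ r s ↦ Σ φ(uᵢ) ⊗ (φᵢ ⊗ s)` well defined, as the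
candidate inverse of the multiplication map `A ⊗_A (S* ⊗_R R) → S* ⊗_R R`. -/
theorem evalTens_rsmul (φ : Dual A S) (r s : R) (x : Tens A S (Dual A S)) :
    evalTens R φ s (x •ᵣ r) = evalTens R φ (r * s) x := by
  induction x using Tens.induction with
  | h0 => rw [zero_rsmul', map_zero, map_zero]
  | ht u ψ => exact congrArg (Tens.tmul A (φ.1 u)) (Tens.rsmul_tmul R ψ r s)
  | ha x y hx hy => rw [RightModule.add_rsmul, map_add, map_add, hx, hy]

theorem evalTens_lsmul (φ : Dual A S) (r s : R) (x : Tens A S (Dual A S)) :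
    evalTens R φ s (r •ₗ x) = evalTens R (φ •ᵣ r) s x := by
  induction x using Tens.induction with
  | h0 => rw [lsmul_zero', map_zero, map_zero]
  | ht u ψ => rfl
  | ha x y hx hy => rw [LeftModule.lsmul_add, map_add, map_add, hx, hy]

theorem evalTens_add_left (φ ψ : Dual A S) (s : R) (x : Tens A S (Dual A S)) :
    evalTens R (φ + ψ) s x = evalTens R φ s x + evalTens R ψ s x := by
  induction x using Tens.induction with
  | h0 => simp only [map_zero, add_zero]
  | ht u χ => exact Tens.add_tmul A (φ.1 u) (ψ.1 u) (Tens.tmul R χ s)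
  | ha x y hx hy => rw [map_add, hx, hy, map_add, map_add, add_add_add_comm]

theorem evalTens_add_right (φ : Dual A S) (s t : R) (x : Tens A S (Dual A S)) :
    evalTens R φ (s + t) x = evalTens R φ s x + evalTens R φ t x := by
  induction x using Tens.induction with
  | h0 => simp only [map_zero, add_zero]
  | ht u χ =>
    exact (congrArg (Tens.tmul A (φ.1 u)) (Tens.tmul_add R χ s t)).trans (Tens.tmul_add A _ _ _)
  | ha x y hx hy => rw [map_add, hx, hy, map_add, map_add, add_add_add_comm]

theorem evalTens_smul (a : A) (φ : Dual A S) (s : R) (x : Tens A S (Dual A S)) :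
    evalTens R (a •ₗ φ) s x =
      Tens.tmul A a (Tens.tmul R (contractLeft (Dual A S) φ.1 (Dual.linear φ) x) s) := by
  induction x using Tens.induction with
  | h0 => simp only [map_zero, Tens.zero_tmul, Tens.tmul_zero]
  | ht u ψ => exact Tens.rsmul_tmul A a (φ.1 u) (Tens.tmul R ψ s)
  | ha x y hx hy => rw [map_add, map_add, hx, hy, Tens.add_tmul, Tens.tmul_add]

theorem lmulMap_evalTens (φ : Dual A S) (s : R) (x : Tens A S (Dual A S)) :
    lmulMap A (Tens R (Dual A S) R) (evalTens R φ s x) =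
      Tens.tmul R (contractLeft (Dual A S) φ.1 (Dual.linear φ) x) s := by
  induction x using Tens.induction with
  | h0 => simp only [map_zero, Tens.zero_tmul]
  | ht u ψ => rfl
  | ha x y hx hy => rw [map_add, map_add, hx, hy, map_add, Tens.add_tmul]

/-- If `S` is `R`-firmly projective, then `S* ⊗_R R` is firm as a left `A`-module. -/
theorem isLeftFirm_dual_tens (hR : IsFirmRing R) (ι : R →ₙ+* ElementaryRing A S)
    (hι : ∀ (r : R) (u : S), r •ₗ u = ι r •ₗ u) : IsLeftFirm A (Tens R (Dual A S) R) := by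
  -- For fixed `φ`, the candidate inverse on `φ ⊗ r s`, as a biadditive function of `r` and `s`;
  -- firmness of `R` turns it into a function of the product.
  let b (φ : Dual A S) : R →+ R →+ Tens A A (Tens R (Dual A S) R) :=
    AddMonoidHom.mk' (fun r => AddMonoidHom.mk' (fun s => evalTens R φ s (toTens ι r))
        (fun s t => evalTens_add_right φ s t _))
      (fun r r' => AddMonoidHom.ext fun s =>
        (congrArg (evalTens R φ s) (map_add (toTens ι) r r')).trans (map_add _ _ _))
  have hb (φ : Dual A S) (r s t : R) : b φ (r •ᵣ s) t = b φ r (s * t) :=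
    (congrArg (evalTens R φ t) (toTens_rightLinear ι hι r s)).trans (evalTens_rsmul φ s t _)
  obtain ⟨L, hL⟩ : ∃ L : Dual A S → R →+ Tens A A (Tens R (Dual A S) R),
      ∀ φ (r s : R), L φ (r •ᵣ s) = evalTens R φ s (toTens ι r) :=
    ⟨fun φ => hR.firm.lift (b φ) (hb φ), fun φ r s => hR.firm.lift_rsmul (b φ) (hb φ) r s⟩
  have hL_add (φ ψ : Dual A S) : L (φ + ψ) = L φ + L ψ := hR.firm.hom_ext fun r s => by
    rw [AddMonoidHom.add_apply, hL, hL, hL, evalTens_add_left]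
  have hL_mul (φ : Dual A S) (t x : R) : L (φ •ᵣ t) x = L φ (t •ₗ x) := by
    induction x using hR.firm.induction with
    | h0 => rw [lsmul_zero', map_zero, map_zero]
    | hs r s => rw [← Bimodule.lsmul_rsmul, hL, hL, toTens_leftLinear ι hι, evalTens_lsmul]
    | ha x y hx hy => rw [LeftModule.lsmul_add, map_add, map_add, hx, hy]
  let β : Tens R (Dual A S) R →+ Tens A A (Tens R (Dual A S) R) :=
    Tens.lift R (AddMonoidHom.mk' L hL_add) hL_mul
  have hβ (φ : Dual A S) (r s : R) :
      β (Tens.tmul R φ (r •ᵣ s)) = evalTens R φ s (toTens ι r) :=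
    hL φ r s
  have hc (φ : Dual A S) (r s : R) :
      Tens.tmul R (contractLeft (Dual A S) φ.1 (Dual.linear φ) (toTens ι r)) s =
        Tens.tmul R φ (r •ᵣ s) := by
    rw [contractLeft_toTens ι hι, Tens.rsmul_tmul]
    rfl
  -- `a φ ⊗ r s` goes to `Σ a φ(uᵢ) ⊗ (φᵢ ⊗ s) = a ⊗ (Σ φ(uᵢ) φᵢ ⊗ s) = a ⊗ (φ r ⊗ s) = a ⊗ (φ ⊗ r
  -- s)`.
  have hleft : β.comp (lmulMap A (Tens R (Dual A S) R)) = AddMonoidHom.id _ :=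
    Tens.hom_ext A fun a x => by
      induction x using Tens.induction with
      | h0 => simp only [Tens.tmul_zero, map_zero]
      | ht φ x =>
        induction x using hR.firm.induction with
        | h0 => simp only [Tens.tmul_zero, map_zero]
        | hs r s =>
          exact (hβ (a •ₗ φ) r s).trans
            ((evalTens_smul a φ s _).trans (congrArg (Tens.tmul A a) (hc φ r s)))
        | ha x y hx hy => simp only [Tens.tmul_add, map_add, hx, hy]
      | ha x y hx hy => simp only [Tens.tmul_add, map_add, hx, hy]
  have hright : (lmulMap A (Tens R (Dual A S) R)).comp β = AddMonoidHom.id _ :=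
    Tens.hom_ext R fun φ x => by
      induction x using hR.firm.induction with
      | h0 => simp only [Tens.tmul_zero, map_zero]
      | hs r s =>
        rw [AddMonoidHom.comp_apply, hβ, lmulMap_evalTens, hc]
        rfl
      | ha x y hx hy => simp only [Tens.tmul_add, map_add, hx, hy]
  exact ⟨Function.LeftInverse.injective (DFunLike.congr_fun hleft),
    Function.RightInverse.surjective (DFunLike.congr_fun hright)⟩

end FirmlyProjective

/-! ### From firm projectivity to a context. -/

section Context

variable {R A : Type u} [NonUnitalRing R] [NonUnitalRing A] {S : FirmBimodule R A}

/-- The firm bimodule `S* ⊗_R R` of an `R`-firmly projective bimodule `S`. -/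
def FirmBimodule.dualTens (hR : IsFirmRing R) (ι : R →ₙ+* ElementaryRing A S)
    (hι : ∀ (r : R) (u : S), r •ₗ u = ι r •ₗ u) : FirmBimodule A R where
  carrier := Tens R (Dual A S) R
  leftFirm := isLeftFirm_dual_tens hR ι hι
  rightFirm := IsRightFirm.tens R R (Dual A S) R hR

/-- Transporting along `e : T ≅ S* ⊗_R R`, the map `j` is `T → S*`, inducing `ε`, and `k s` sends `u
⊗ φ` to `u ⊗ e⁻¹(φ ⊗ s)`. -/
theorem nonempty_context_of_iso (hR : IsFirmRing R) (T : FirmBimodule A R)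
    (h : IsFirmlyProjective A S R) (hT : BimoduleIso A R T (Tens R (Dual A S) R)) :
    Nonempty (ComatrixCoringContext R A S T) := by
  obtain ⟨ι, hι, -⟩ := h
  obtain ⟨e, hel, her⟩ := hT
  have hel' : ∀ (a : A) x, e.symm (a •ₗ x) = a •ₗ e.symm x := fun a x =>
    (AddEquiv.symm_apply_eq e).2 (((hel a (e.symm x)).trans
      (congrArg (a •ₗ ·) (e.apply_symm_apply x))).symm)
  have her' : ∀ x (r : R), e.symm (x •ᵣ r) = e.symm x •ᵣ r := fun x r =>
    (AddEquiv.symm_apply_eq e).2 (((her (e.symm x) r).trans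
      (congrArg (· •ᵣ r) (e.apply_symm_apply x))).symm)
  let j : T →+ Dual A S := (rmulMap R (Dual A S)).comp e.toAddMonoidHom
  have hjl : IsLeftLinear A j := fun a t =>
    (congrArg (rmulMap R (Dual A S)) (hel a t)).trans (rmulMap_leftLinear A R _ a (e t))
  have hjr : IsRightLinear R j := fun t r =>
    (congrArg (rmulMap R (Dual A S)) (her t r)).trans (rmulMap_rightLinear R _ (e t) r)
  let g (s : R) : Dual A S →+ T := e.symm.toAddMonoidHom.comp ((Tens.mk R (Dual A S) R).flip s)
  have hg (s : R) : IsLeftLinear A (g s) := fun a φ => hel' a (Tens.tmul R φ s)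
  let k (s : R) : Tens A S (Dual A S) →+ Tens A S T :=
    Tens.map A (AddMonoidHom.id S) (g s) (IsRightLinear.id A) (hg s)
  have hk_add (s t : R) (x) : k (s + t) x = k s x + k t x := by
    induction x using Tens.induction with
    | h0 => simp only [map_zero, add_zero]
    | ht u φ =>
      exact (congrArg (Tens.tmul A u) ((congrArg e.symm (Tens.tmul_add R φ s t)).trans
        (map_add e.symm _ _))).trans (Tens.tmul_add A u _ _)
    | ha x y hx hy => rw [map_add, hx, hy, map_add, map_add, add_add_add_comm]
  have hk_mul (r s : R) (x) : k s (x •ᵣ r) = k (r * s) x := by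
    induction x using Tens.induction with
    | h0 => rw [zero_rsmul', map_zero, map_zero]
    | ht u φ => exact congrArg (fun y => Tens.tmul A u (e.symm y)) (Tens.rsmul_tmul R φ r s)
    | ha x y hx hy => rw [RightModule.add_rsmul, map_add, map_add, hx, hy]
  have hk_left (r s : R) (x) : k s (r •ₗ x) = r •ₗ k s x := by
    induction x using Tens.induction with
    | h0 => rw [lsmul_zero', map_zero, lsmul_zero']
    | ht u φ => rfl
    | ha x y hx hy => rw [LeftModule.lsmul_add, map_add, map_add, hx, hy, LeftModule.lsmul_add]
  have hk_right (r s : R) (x) : k s x •ᵣ r = k (s * r) x := by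
    induction x using Tens.induction with
    | h0 => rw [map_zero, zero_rsmul', map_zero]
    | ht u φ => exact congrArg (Tens.tmul A u) (her' (Tens.tmul R φ s) r).symm
    | ha x y hx hy => rw [map_add, RightModule.add_rsmul, map_add, hx, hy]
  -- `ι(r)` lies in `S ⊗_A S*`, not in `S ⊗_A T`; the second factor `s` of a product `r s` lifts
  -- `φᵢ` to `φᵢ ⊗ s`.
  let η : R →+ Tens A S T := hR.firm.lift
    (AddMonoidHom.mk' (fun r => AddMonoidHom.mk' (fun s => k s (toTens ι r))
        (fun s t => hk_add s t _))
      (fun r r' => AddMonoidHom.ext fun s =>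
        (congrArg (k s) (map_add (toTens ι) r r')).trans (map_add _ _ _)))
    (fun r s t => (congrArg (k t) (toTens_rightLinear ι hι r s)).trans (hk_mul s t _))
  have hη (r s : R) : η (r •ᵣ s) = k s (toTens ι r) := hR.firm.lift_rsmul _ _ r s
  let ε : Tens R T S →+ A := Tens.lift R
    (AddMonoidHom.mk' (fun t => (j t).1) (fun t t' => congrArg Subtype.val (map_add j t t')))
    (fun t r u => congrArg (fun φ : Dual A S => φ.1 u) (hjr t r))
  have hε : IsBilinear A A ε := by
    refine ⟨fun a x => ?_, fun x a => ?_⟩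
    · induction x using Tens.induction with
      | h0 => rw [lsmul_zero', map_zero, lsmul_zero']
      | ht t u => exact congrArg (fun φ : Dual A S => φ.1 u) (hjl a t)
      | ha x y hx hy => rw [LeftModule.lsmul_add, map_add, map_add, hx, hy, LeftModule.lsmul_add]
    · induction x using Tens.induction with
      | h0 => rw [zero_rsmul', map_zero, zero_rsmul']
      | ht t u => exact (j t).2 u a
      | ha x y hx hy =>
        rw [RightModule.add_rsmul, map_add, map_add, hx, hy, RightModule.add_rsmul]
  refine ⟨ComatrixCoringContext.ofElements η ε ⟨fun r x => ?_, fun x r => ?_⟩ hε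
    (fun x u => ?_) (fun t x => ?_)⟩
  · induction x using hR.firm.induction with
    | h0 => rw [lsmul_zero', map_zero, lsmul_zero']
    | hs s t =>
      rw [← Bimodule.lsmul_rsmul, hη, hη, toTens_leftLinear ι hι, hk_left]
    | ha x y hx hy => rw [LeftModule.lsmul_add, map_add, map_add, hx, hy, LeftModule.lsmul_add]
  · induction x using hR.firm.induction with
    | h0 => rw [zero_rsmul', map_zero, zero_rsmul']
    | hs s t =>
      rw [← RightModule.rsmul_mul, hη, hη, hk_right]
    | ha x y hx hy => rw [RightModule.add_rsmul, map_add, map_add, hx, hy, RightModule.add_rsmul]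
  -- Since `j(e⁻¹(φ ⊗ s)) = φ s`, contracting `k s z` gives `z (s u)`; for `z = ι(r)` this is `r (s
  -- u)`.
  · have key (s : R) (z) : contractRight S (evalAt ε u) (evalAt_leftLinear hε u) (k s z) =
        ElementaryRing.act A S z (s •ₗ u) := by
      refine DFunLike.congr_fun (Tens.hom_ext A
        (f := (contractRight S (evalAt ε u) (evalAt_leftLinear hε u)).comp (k s))
        (g := ((ElementaryRing.act A S).flip (s •ₗ u) : Tens A S (Dual A S) →+ S))
        fun v φ => ?_) z
      have : j (e.symm (Tens.tmul R φ s)) = φ •ᵣ s :=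
        congrArg (rmulMap R (Dual A S)) (e.apply_symm_apply (Tens.tmul R φ s))
      exact congrArg (fun ψ : Dual A S => v •ᵣ ψ.1 u) this
    induction x using hR.firm.induction with
    | h0 => rw [map_zero, map_zero, zero_lsmul']
    | hs r s =>
      rw [hη, key]
      exact (hι r (s •ₗ u)).symm.trans (LeftModule.mul_lsmul r s u).symm
    | ha x y hx hy => rw [map_add, map_add, hx, hy, LeftModule.add_lsmul]
  -- For `z = ι(r)` the result is `e⁻¹(j(t) r ⊗ s) = e⁻¹(j(t) ⊗ r s)`. As `j(t)` is the product of
  -- `e(t)` in `S*`, this equals `e⁻¹(e(t) (r s)) = t (r s)`.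
  · have key (s : R) (z) : contractLeft T (evalBy ε t) (evalBy_rightLinear hε t) (k s z) =
        e.symm (Tens.tmul R (contractLeft (Dual A S) (j t).1 (Dual.linear (j t)) z) s) := by
      induction z using Tens.induction with
      | h0 => simp only [map_zero, Tens.zero_tmul]
      | ht v φ => exact (hel' ((j t).1 v) (Tens.tmul R φ s)).symm
      | ha x y hx hy => rw [map_add, map_add, hx, hy, map_add, Tens.add_tmul, map_add]
    induction x using hR.firm.induction with
    | h0 => rw [map_zero, map_zero, rsmul_zero']
    | hs r s =>
      rw [hη, key, contractLeft_toTens ι hι, Tens.rsmul_tmul]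
      refine (congrArg e.symm (Tens.rsmul_eq_rmulMap_tmul (e t) (r * s)).symm).trans ?_
      rw [her', e.symm_apply_apply]
      rfl
    | ha x y hx hy => rw [map_add, map_add, hx, hy, RightModule.rsmul_add]

end Context

/-! ### From a context to firm projectivity and the shape of `T`. -/

namespace ComatrixCoringContext

variable {R A : Type u} [NonUnitalRing R] [NonUnitalRing A] {S : FirmBimodule R A}
  {T : FirmBimodule A R} (c : ComatrixCoringContext R A S T)

/-- The map `t ↦ ε(t ⊗ -)` from `T` to `S*`. -/
def toDual : T →+ Dual A S :=
  AddMonoidHom.mk' (fun t => ⟨evalBy c.ε t, evalBy_rightLinear c.ε_bilinear t⟩)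
    (fun t t' => Subtype.ext (AddMonoidHom.ext fun u =>
      (congrArg c.ε (Tens.add_tmul R t t' u)).trans (map_add c.ε _ _)))

theorem toDual_leftLinear : IsLeftLinear A c.toDual := fun a t =>
  Subtype.ext (AddMonoidHom.ext fun u => c.ε_bilinear.1 a (Tens.tmul R t u))

theorem toDual_rightLinear : IsRightLinear R c.toDual := fun t r =>
  Subtype.ext (AddMonoidHom.ext fun u => congrArg c.ε (Tens.rsmul_tmul R t r u))

/-- The map `S ⊗_A T → S ⊗_A S*`. -/
def toElementaryRing : Tens A S T →+ ElementaryRing A S :=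
  Tens.map A (AddMonoidHom.id S) c.toDual (IsRightLinear.id A) c.toDual_leftLinear

theorem act_toElementaryRing (x : Tens A S T) (u : S) :
    ElementaryRing.act A S (c.toElementaryRing x) u =
      contractRight S (evalAt c.ε u) (evalAt_leftLinear c.ε_bilinear u) x :=
  DFunLike.congr_fun (Tens.hom_ext A
    (f := ((ElementaryRing.act A S).flip u).comp c.toElementaryRing)
    (g := contractRight S (evalAt c.ε u) (evalAt_leftLinear c.ε_bilinear u))
    fun _ _ => rfl) x

theorem act_toElementaryRing_η (r : R) (u : S) :
    ElementaryRing.act A S (c.toElementaryRing (c.η r)) u = r •ₗ u :=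
  (c.act_toElementaryRing _ u).trans (c.contractRight_η r u)

theorem toElementaryRing_lsmul (r : R) (x : Tens A S T) :
    c.toElementaryRing (r •ₗ x) = lactHom R (Tens A S (Dual A S)) r (c.toElementaryRing x) :=
  DFunLike.congr_fun (Tens.hom_ext A
    (f := c.toElementaryRing.comp (lactHom R (Tens A S T) r))
    (g := (lactHom R (Tens A S (Dual A S)) r :
      ElementaryRing A S →+ ElementaryRing A S).comp c.toElementaryRing)
    fun _ _ => rfl) x

-- By the first triangle identity the image of `η(r)` in `Z` acts on `S` as `r`. Multiplicativity
-- follows: `η(r s) = r η(s)`, and acting by `r` on `Z` is multiplying by that image.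
include c in
theorem isFirmlyProjective : IsFirmlyProjective A S R :=
  ⟨{ toFun := fun r => c.toElementaryRing (c.η r)
     map_zero' := by rw [map_zero, map_zero]
     map_add' := fun r s => by rw [map_add, map_add]
     map_mul' := fun r s =>
      (congrArg c.toElementaryRing (c.η_bilinear.1 r s)).trans
        ((c.toElementaryRing_lsmul r (c.η s)).trans
          (ElementaryRing.mul_eq_lsmul (c.act_toElementaryRing_η r) _).symm) },
    fun r u => (c.act_toElementaryRing_η r u).symm, S.leftFirm⟩

/-- The first triangle identity tested by `φ`. It shows that `T → S*` reaches every `φ r`. -/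
theorem toDual_contractLeft (φ : Dual A S) (r : R) :
    c.toDual (contractLeft T φ.1 (Dual.linear φ) (c.η r)) = φ •ᵣ r :=
  Subtype.ext (AddMonoidHom.ext fun u =>
    (map_contractLeft φ.1 (Dual.linear φ) (evalAt c.ε u) (evalAt_leftLinear c.ε_bilinear u)
      (c.η r)).trans (congrArg φ.1 (c.contractRight_η r u)))

-- The inverse maps are `t r ↦ ε(t ⊗ -) ⊗ r` and `φ ⊗ r ↦ (φ ⊗ T)(η(r))`. One composite is the
-- identity by the second triangle identity, the other by the first in the form
-- `toDual_contractLeft`.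
include c in
theorem bimoduleIso (hR : IsFirmRing R) : BimoduleIso A R T (Tens R (Dual A S) R) := by
  let f : T →+ Tens R (Dual A S) R := T.rightFirm.lift ((Tens.mk R (Dual A S) R).comp c.toDual)
    (fun t r s => by
      simp only [AddMonoidHom.comp_apply, Tens.mk_apply, c.toDual_rightLinear t r]
      exact Tens.rsmul_tmul R (c.toDual t) r s)
  have hf (t : T) (r : R) : f (t •ᵣ r) = Tens.tmul R (c.toDual t) r :=
    T.rightFirm.lift_rsmul _ _ t r
  let g : Tens R (Dual A S) R →+ T := Tens.lift R
    (AddMonoidHom.mk' (fun φ => (contractLeft T φ.1 (Dual.linear φ)).comp c.η)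
      (fun φ ψ => AddMonoidHom.ext fun r => contractLeft_add φ ψ (c.η r)))
    (fun φ r s => ((congrArg (contractLeft T φ.1 (Dual.linear φ)) (c.η_bilinear.1 r s)).trans
      (contractLeft_lsmul φ r (c.η s))).symm)
  have hg (φ : Dual A S) (r : R) :
      g (Tens.tmul R φ r) = contractLeft T φ.1 (Dual.linear φ) (c.η r) := rfl
  have hgf : g.comp f = AddMonoidHom.id T := T.rightFirm.hom_ext fun t r => by
    rw [AddMonoidHom.comp_apply, hf, hg]
    exact c.contractLeft_η t r
  have hfg : f.comp g = AddMonoidHom.id _ := Tens.hom_ext R fun φ x => by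
    induction x using hR.firm.induction with
    | h0 => simp only [Tens.tmul_zero, map_zero]
    | hs r s =>
      rw [AddMonoidHom.comp_apply, hg, c.η_bilinear.2, contractLeft_rightLinear, hf,
        toDual_contractLeft, Tens.rsmul_tmul]
      rfl
    | ha x y hx hy => simp only [Tens.tmul_add, map_add, hx, hy]
  refine ⟨AddMonoidHom.toAddEquiv f g hgf hfg, fun a t => ?_, fun t r => ?_⟩
  · change f (a •ₗ t) = a •ₗ f t
    induction t using T.rightFirm.induction with
    | h0 => rw [lsmul_zero', map_zero, lsmul_zero']
    | hs t r => rw [← Bimodule.lsmul_rsmul, hf, hf, c.toDual_leftLinear]; rfl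
    | ha x y hx hy => rw [LeftModule.lsmul_add, map_add, map_add, hx, hy, LeftModule.lsmul_add]
  · change f (t •ᵣ r) = f t •ᵣ r
    induction t using T.rightFirm.induction with
    | h0 => rw [zero_rsmul', map_zero, zero_rsmul']
    | hs t s => rw [← RightModule.rsmul_mul, hf, hf]; rfl
    | ha x y hx hy => rw [RightModule.add_rsmul, map_add, map_add, hx, hy, RightModule.add_rsmul]

end ComatrixCoringContext

/-! ### From a context to an adjunction. -/

section Linearity

theorem Tens.map_rightLinear {R A M M' N N' : Type*} [NonUnitalRing R] [NonUnitalRing A]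
    [AddCommGroup M] [AddCommGroup M'] [AddCommGroup N] [AddCommGroup N'] [RightModule R M]
    [RightModule R M'] [LeftModule R N] [LeftModule R N'] [RightModule A N] [RightModule A N']
    [Bimodule R A N] [Bimodule R A N'] {f : M →+ M'} {g : N →+ N'} (hf : IsRightLinear R f)
    (hg : IsLeftLinear R g) (hg' : IsRightLinear A g) :
    IsRightLinear A (map R f g hf hg) := by
  intro x a
  induction x using Tens.induction with
  | h0 => rw [zero_rsmul', map_zero, zero_rsmul']
  | ht m n => exact congrArg (tmul R (f m)) (hg' n a)
  | ha x y hx hy => rw [RightModule.add_rsmul, map_add, map_add, hx, hy, RightModule.add_rsmul]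

theorem lmulMap_rightLinear (R A M : Type*) [NonUnitalRing R] [NonUnitalRing A] [AddCommGroup M]
    [LeftModule R M] [RightModule A M] [Bimodule R A M] : IsRightLinear A (lmulMap R M) := by
  intro x a
  induction x using Tens.induction with
  | h0 => rw [zero_rsmul', map_zero, zero_rsmul']
  | ht r m => exact (Bimodule.lsmul_rsmul r m a).symm
  | ha x y hx hy => rw [RightModule.add_rsmul, map_add, map_add, hx, hy, RightModule.add_rsmul]

end Linearity

section Adjunction

variable {R A : Type u} [NonUnitalRing R] [NonUnitalRing A] {S : FirmBimodule R A}
  {T : FirmBimodule A R}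

namespace FirmMod

/-- The map `r ↦ m r`. -/
def orbit (hR : IsFirmRing R) {M : FirmMod R} (m : M) : self R hR ⟶ M :=
  Hom.mk (M := self R hR) (@ractHom R M _ _ _ m) (@RightModule.rsmul_mul R M _ _ _ m)

end FirmMod

namespace ComatrixCoringContext

variable (c : ComatrixCoringContext R A S T)

section Maps

variable {M N : Type*} [AddCommGroup M] [AddCommGroup N] [RightModule R M] [RightModule A N]

/-- The unit `m r ↦ m ⊗ η(r)`. -/
noncomputable def unitHom (hM : IsRightFirm R M) : M →+ Tens A (Tens R M S) T :=
  hM.lift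
    (AddMonoidHom.mk' (fun m => ((Tens.assocInv A R M S T).comp (Tens.mk R M (Tens A S T) m)).comp
        c.η)
      (fun m m' => AddMonoidHom.ext fun r =>
        (congrArg (Tens.assocInv A R M S T) (Tens.add_tmul R m m' (c.η r))).trans (map_add _ _ _)))
    (fun m r s => congrArg (Tens.assocInv A R M S T)
      ((Tens.rsmul_tmul R m r (c.η s)).trans
        (congrArg (Tens.tmul R m) (c.η_bilinear.1 r s).symm)))

theorem unitHom_rsmul (hM : IsRightFirm R M) (m : M) (r : R) :
    c.unitHom hM (m •ᵣ r) = Tens.assocInv A R M S T (Tens.tmul R m (c.η r)) :=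
  hM.lift_rsmul _ _ m r

variable (N) in
/-- The counit `(n ⊗ t) ⊗ u ↦ n ε(t ⊗ u)`. -/
def counitHom : Tens R (Tens A N T) S →+ N :=
  (rmulMap A N).comp ((Tens.map A (AddMonoidHom.id N) c.ε (IsRightLinear.id A)
    c.ε_bilinear.1).comp (Tens.assocHom R A N T S))

variable (S T M) in
theorem assocInv_rightLinear : IsRightLinear R (Tens.assocInv A R M S T) := by
  intro x r
  induction x using Tens.induction with
  | h0 => rw [zero_rsmul', map_zero, zero_rsmul']
  | ht m x =>
    induction x using Tens.induction with
    | h0 => rw [Tens.tmul_zero, zero_rsmul', map_zero, zero_rsmul']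
    | ht u t => rfl
    | ha x y hx hy =>
      rw [Tens.tmul_add, RightModule.add_rsmul, map_add, map_add, hx, hy, RightModule.add_rsmul]
  | ha x y hx hy => rw [RightModule.add_rsmul, map_add, map_add, hx, hy, RightModule.add_rsmul]

theorem unitHom_linear (hM : IsRightFirm R M) : IsRightLinear R (c.unitHom hM) := by
  intro x r
  induction x using hM.induction with
  | h0 => rw [zero_rsmul', map_zero, zero_rsmul']
  | hs m s =>
    rw [← RightModule.rsmul_mul, unitHom_rsmul, unitHom_rsmul, ← assocInv_rightLinear]
    exact congrArg (fun x => Tens.assocInv A R M S T (Tens.tmul R m x)) (c.η_bilinear.2 s r)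
  | ha x y hx hy => rw [RightModule.add_rsmul, map_add, map_add, hx, hy, RightModule.add_rsmul]

variable (N) in
theorem counitHom_linear : IsRightLinear A (c.counitHom N) := by
  intro x a
  induction x using Tens.induction with
  | h0 => rw [zero_rsmul', map_zero, zero_rsmul']
  | ht y u =>
    induction y using Tens.induction with
    | h0 => rw [Tens.zero_tmul, zero_rsmul', map_zero, zero_rsmul']
    | ht n t =>
      exact (congrArg (n •ᵣ ·) (c.ε_bilinear.2 (Tens.tmul R t u) a)).trans
        (RightModule.rsmul_mul n (c.ε (Tens.tmul R t u)) a)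
    | ha x y hx hy =>
      rw [Tens.add_tmul, RightModule.add_rsmul, map_add, map_add, hx, hy, RightModule.add_rsmul]
  | ha x y hx hy => rw [RightModule.add_rsmul, map_add, map_add, hx, hy, RightModule.add_rsmul]

/-- With `x = η(r)` this reduces the triangle for `- ⊗_R S` to the identity `contractRight_η`;
`map_counitHom_assocInv` does the same for `- ⊗_A T` and `contractLeft_η`. -/
theorem counitHom_assocInv (m : M) (u : S) (x : Tens A S T) :
    c.counitHom (Tens R M S) (Tens.tmul R (Tens.assocInv A R M S T (Tens.tmul R m x)) u) =
    Tens.tmul R m (contractRight S (evalAt c.ε u) (evalAt_leftLinear c.ε_bilinear u) x) := by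
  induction x using Tens.induction with
  | h0 => simp only [Tens.tmul_zero, Tens.zero_tmul, map_zero]
  | ht v t => rfl
  | ha x y hx hy =>
    rw [Tens.tmul_add, map_add, Tens.add_tmul, map_add, hx, hy, map_add, Tens.tmul_add]

theorem map_counitHom_assocInv (n : N) (t : T) (x : Tens A S T) :
    Tens.map A (c.counitHom N) (AddMonoidHom.id T) (c.counitHom_linear N) (IsLeftLinear.id A)
      (Tens.assocInv A R (Tens A N T) S T (Tens.tmul R (Tens.tmul A n t) x)) =
    Tens.tmul A n (contractLeft T (evalBy c.ε t) (evalBy_rightLinear c.ε_bilinear t) x) := by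
  induction x using Tens.induction with
  | h0 => simp only [Tens.tmul_zero, map_zero]
  | ht v t' => exact Tens.rsmul_tmul A n (c.ε (Tens.tmul R t v)) t'
  | ha x y hx hy => rw [Tens.tmul_add, map_add, map_add, map_add, Tens.tmul_add, ← hx, ← hy]

theorem counitHom_unitHom (hM : IsRightFirm R M) :
    (c.counitHom (Tens R M S)).comp
      (Tens.map R (c.unitHom hM) (AddMonoidHom.id S) (c.unitHom_linear hM) (IsLeftLinear.id R)) =
    AddMonoidHom.id (Tens R M S) :=
  Tens.hom_ext R fun x u => by
    rw [AddMonoidHom.comp_apply, Tens.map_tmul, AddMonoidHom.id_apply, AddMonoidHom.id_apply]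
    induction x using hM.induction with
    | h0 => simp only [map_zero, Tens.zero_tmul]
    | hs m r => rw [unitHom_rsmul, counitHom_assocInv, contractRight_η, Tens.rsmul_tmul]
    | ha x y hx hy => rw [map_add, Tens.add_tmul, map_add, hx, hy, Tens.add_tmul]

theorem map_counitHom_unitHom (h : IsRightFirm R (Tens A N T)) :
    (Tens.map A (c.counitHom N) (AddMonoidHom.id T) (c.counitHom_linear N)
      (IsLeftLinear.id A)).comp (c.unitHom h) = AddMonoidHom.id (Tens A N T) :=
  Tens.hom_ext A fun n t => by
    rw [AddMonoidHom.comp_apply, AddMonoidHom.id_apply]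
    induction t using T.rightFirm.induction with
    | h0 => simp only [Tens.tmul_zero, map_zero]
    | hs t r => rw [← Tens.tmul_rsmul, unitHom_rsmul, map_counitHom_assocInv, contractLeft_η]; rfl
    | ha x y hx hy => rw [Tens.tmul_add, map_add, map_add, hx, hy]

theorem unitHom_naturality {M' : Type*} [AddCommGroup M'] [RightModule R M']
    (hM : IsRightFirm R M) (hM' : IsRightFirm R M') (f : M →+ M') (hf : IsRightLinear R f)
    (hf' : IsRightLinear A (Tens.map R f (AddMonoidHom.id S) hf (IsLeftLinear.id R))) :
    (c.unitHom hM').comp f =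
      (Tens.map A (Tens.map R f (AddMonoidHom.id S) hf (IsLeftLinear.id R)) (AddMonoidHom.id T) hf'
        (IsLeftLinear.id A)).comp (c.unitHom hM) :=
  hM.hom_ext fun m r => by
    rw [AddMonoidHom.comp_apply, AddMonoidHom.comp_apply, hf, unitHom_rsmul, unitHom_rsmul]
    generalize c.η r = x
    induction x using Tens.induction with
    | h0 => simp only [Tens.tmul_zero, map_zero]
    | ht u t => rfl
    | ha x y hx hy => simp only [Tens.tmul_add, map_add, hx, hy]

theorem counitHom_naturality {N' : Type*} [AddCommGroup N'] [RightModule A N'] (f : N →+ N')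
    (hf : IsRightLinear A f)
    (hf' : IsRightLinear R (Tens.map A f (AddMonoidHom.id T) hf (IsLeftLinear.id A))) :
    (c.counitHom N').comp (Tens.map R (Tens.map A f (AddMonoidHom.id T) hf (IsLeftLinear.id A))
      (AddMonoidHom.id S) hf' (IsLeftLinear.id R)) = f.comp (c.counitHom N) :=
  Tens.hom_ext R fun x u => by
    induction x using Tens.induction with
    | h0 => simp only [Tens.zero_tmul, map_zero]
    | ht n t => exact (hf n (c.ε (Tens.tmul R t u))).symm
    | ha x y hx hy => simp only [Tens.add_tmul, map_add, hx, hy]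

end Maps

/-- The adjunction given by a comatrix coring context. -/
noncomputable def adjunction : FirmMod.tensFunctor S ⊣ FirmMod.tensFunctor T where
  unit :=
    { app := fun M => FirmMod.Hom.mk (N := (FirmMod.tensFunctor T).obj
        ((FirmMod.tensFunctor S).obj M)) (c.unitHom M.firm) (c.unitHom_linear M.firm)
      naturality := fun M M' f => FirmMod.Hom.ext
        (c.unitHom_naturality M.firm M'.firm f.hom f.linear
          ((FirmMod.tensFunctor S).map f).linear) }
  counit :=
    { app := fun N => FirmMod.Hom.mk (M := (FirmMod.tensFunctor S).obj
        ((FirmMod.tensFunctor T).obj N)) (c.counitHom N) (c.counitHom_linear N)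
      naturality := fun _ _ f => FirmMod.Hom.ext
        (c.counitHom_naturality f.hom f.linear ((FirmMod.tensFunctor T).map f).linear) }
  left_triangle_components M := FirmMod.Hom.ext (c.counitHom_unitHom M.firm)
  right_triangle_components N := FirmMod.Hom.ext
    (c.map_counitHom_unitHom ((FirmMod.tensFunctor T).obj N).firm)

end ComatrixCoringContext

/-! ### From an adjunction to a context. -/

namespace FirmMod

variable (adj : tensFunctor S ⊣ tensFunctor T)

/-- The unit of an adjunction between tensor functors, as an additive map. -/
def unitHom (M : FirmMod R) : M →+ Tens A (Tens R M S) T := (adj.unit.app M).hom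

/-- The counit of an adjunction between tensor functors, as an additive map. -/
def counitHom (N : FirmMod A) : Tens R (Tens A N T) S →+ N := (adj.counit.app N).hom

theorem unitHom_linear (M : FirmMod R) : IsRightLinear R (unitHom adj M) :=
  (adj.unit.app M).linear

theorem counitHom_linear (N : FirmMod A) : IsRightLinear A (counitHom adj N) :=
  (adj.counit.app N).linear

/-- Naturality along `r ↦ m r`: the component at `R` determines the unit on all products, hence on
every firm module. -/
theorem unitHom_orbit (hR : IsFirmRing R) (M : FirmMod R) (m : M) (r : R) :
    unitHom adj M (m •ᵣ r) = ((tensFunctor T).map ((tensFunctor S).map (orbit hR m))).hom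
      (unitHom adj (self R hR) r) :=
  congrArg (fun f => f.hom r) (adj.unit.naturality (orbit hR m))

theorem counitHom_orbit (hA : IsFirmRing A) (N : FirmMod A) (n : N) (a : A) (t : T) (u : S) :
    counitHom adj N (Tens.tmul R (Tens.tmul A (n •ᵣ a) t) u) =
      ractHom A N n (counitHom adj (self A hA) (Tens.tmul R (Tens.tmul A a t) u)) :=
  congrArg (fun f => f.hom (Tens.tmul R (Tens.tmul A a t) u))
    (adj.counit.naturality (orbit hA n))

theorem counitHom_unitHom (M : FirmMod R) (m : M) (u : S) :
    counitHom adj ((tensFunctor S).obj M) (Tens.tmul R (unitHom adj M m) u) = Tens.tmul R m u :=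
  congrArg (fun f => f.hom (Tens.tmul R m u)) (adj.left_triangle_components M)

theorem map_counitHom_unitHom (N : FirmMod A) (x : Tens A N T) :
    Tens.map A (counitHom adj N) (AddMonoidHom.id T) (counitHom_linear adj N) (IsLeftLinear.id A)
      (unitHom adj ((tensFunctor T).obj N) x) = x :=
  congrArg (fun f => f.hom x) (adj.right_triangle_components N)

/-- The coevaluation map of an adjunction between tensor functors. -/
def coev (hR : IsFirmRing R) : R →+ Tens A S T :=
  (Tens.map A (lmulMap R S) (AddMonoidHom.id T) (lmulMap_rightLinear R A S)
    (IsLeftLinear.id A)).comp (unitHom adj (self R hR))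

/-- The evaluation map of an adjunction between tensor functors. -/
noncomputable def ev (hA : IsFirmRing A) : Tens R T S →+ A :=
  (counitHom adj (self A hA)).comp
    (Tens.map R (AddEquiv.ofBijective (lmulMap A T) T.leftFirm).symm.toAddMonoidHom
      (AddMonoidHom.id S)
      (fun t r => (AddEquiv.symm_apply_eq _).2 <| by
        refine Eq.trans ?_ (lmulMap_rightLinear A R T _ r).symm
        exact congrArg (· •ᵣ r)
          ((AddEquiv.ofBijective (lmulMap A T) T.leftFirm).apply_symm_apply t).symm)
      (IsLeftLinear.id R))

theorem ev_lmulMap (hA : IsFirmRing A) (y : Tens A A T) (u : S) :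
    ev adj hA (Tens.tmul R (lmulMap A T y) u) = counitHom adj (self A hA) (Tens.tmul R y u) :=
  congrArg (fun y : Tens A A T => counitHom adj (self A hA) (Tens.tmul R y u))
    ((AddEquiv.ofBijective (lmulMap A T) T.leftFirm).symm_apply_apply y)

/-- Writing `t` as a sum of products `a t'` moves `a` across to `n`, and naturality along `a ↦ n a`
reduces to the component at `A`. -/
theorem counitHom_tmul (hA : IsFirmRing A) (N : FirmMod A) (n : N) (t : T) (u : S) :
    counitHom adj N (Tens.tmul R (Tens.tmul A n t) u) = n •ᵣ ev adj hA (Tens.tmul R t u) := by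
  induction t using T.leftFirm.induction with
  | h0 => rw [Tens.tmul_zero, Tens.zero_tmul, Tens.zero_tmul, map_zero, map_zero, rsmul_zero']
  | hs a t =>
    rw [← Tens.rsmul_tmul, counitHom_orbit adj hA]
    exact congrArg (n •ᵣ ·) (ev_lmulMap adj hA (Tens.tmul A a t) u).symm
  | ha x y hx hy =>
    rw [Tens.tmul_add, Tens.add_tmul, Tens.add_tmul, map_add, map_add, hx, hy,
      RightModule.rsmul_add]

theorem unitHom_rsmul (hR : IsFirmRing R) (M : FirmMod R) (m : M) (r : R) :
    unitHom adj M (m •ᵣ r) = Tens.assocInv A R M S T (Tens.tmul R m (coev adj hR r)) := by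
  refine (unitHom_orbit adj hR M m r).trans (DFunLike.congr_fun (Tens.hom_ext A
    (f := (((tensFunctor T).map ((tensFunctor S).map (orbit hR m))).hom :
      Tens A (Tens R R S) T →+ Tens A (Tens R M S) T))
    (g := ((Tens.assocInv A R M S T).comp (Tens.mk R M (Tens A S T) m)).comp
      (Tens.map A (lmulMap R S) (AddMonoidHom.id T) (lmulMap_rightLinear R A S)
        (IsLeftLinear.id A))) fun x t => ?_) (unitHom adj (self R hR) r))
  have : ((tensFunctor S).map (orbit hR m)).hom x = Tens.tmul R m (lmulMap R S x) := by
    refine DFunLike.congr_fun (Tens.hom_ext R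
      (f := (((tensFunctor S).map (orbit hR m)).hom : Tens R R S →+ Tens R M S))
      (g := (Tens.mk R M S m).comp (lmulMap R S)) fun s u => Tens.rsmul_tmul R m s u) x
  exact congrArg (fun y : Tens R M S => Tens.tmul A y t) this

theorem map_lmulMap_assocInv (r : R) (x : Tens A S T) :
    Tens.map A (lmulMap R S) (AddMonoidHom.id T) (lmulMap_rightLinear R A S)
      (IsLeftLinear.id A) (Tens.assocInv A R R S T (Tens.tmul R r x)) = r •ₗ x :=
  DFunLike.congr_fun (Tens.hom_ext A
    (f := (Tens.map A (lmulMap R S) (AddMonoidHom.id T) (lmulMap_rightLinear R A S)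
      (IsLeftLinear.id A)).comp ((Tens.assocInv A R R S T).comp (Tens.mk R R (Tens A S T) r)))
    (g := lactHom R (Tens A S T) r) fun _ _ => rfl) x

theorem coev_bilinear (hR : IsFirmRing R) : IsBilinear R R (coev adj hR) :=
  ⟨fun r s => (congrArg _ (unitHom_rsmul adj hR (self R hR) r s)).trans
      (map_lmulMap_assocInv r (coev adj hR s)),
    fun s r => (congrArg _ (unitHom_linear adj (self R hR) s r)).trans
      (Tens.map_rightLinear (lmulMap_rightLinear R A S) (IsLeftLinear.id A) (IsRightLinear.id R)
        (unitHom adj (self R hR) s) r)⟩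

theorem ev_bilinear (hA : IsFirmRing A) : IsBilinear A A (ev adj hA) := by
  refine ⟨fun a x => ?_, fun x a => ?_⟩
  · induction x using Tens.induction with
    | h0 => rw [lsmul_zero', map_zero, lsmul_zero']
    | ht t u =>
      exact (ev_lmulMap adj hA (Tens.tmul A a t) u).trans (counitHom_tmul adj hA (self A hA) a t u)
    | ha x y hx hy => rw [LeftModule.lsmul_add, map_add, map_add, hx, hy, LeftModule.lsmul_add]
  · induction x using Tens.induction with
    | h0 => rw [zero_rsmul', map_zero, zero_rsmul']
    | ht t u => exact counitHom_linear adj (self A hA) (Tens.tmul R _ u) a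
    | ha x y hx hy => rw [RightModule.add_rsmul, map_add, map_add, hx, hy, RightModule.add_rsmul]

/-- The comatrix coring context given by an adjunction between tensor functors. -/
noncomputable def contextOfAdjunction (hR : IsFirmRing R) (hA : IsFirmRing A) :
    ComatrixCoringContext R A S T :=
  .ofElements (coev adj hR) (ev adj hA) (coev_bilinear adj hR) (ev_bilinear adj hA)
    (fun r u => by
      -- For `x` the unit at `R` of `r`, the triangle at `R` turns the right side into the product
      -- of `r ⊗ u`.
      have key (x : Tens A (Tens R R S) T) :
          contractRight S (evalAt (ev adj hA) u) (evalAt_leftLinear (ev_bilinear adj hA) u)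
            (Tens.map A (lmulMap R S) (AddMonoidHom.id T) (lmulMap_rightLinear R A S)
              (IsLeftLinear.id A) x) =
          lmulMap R S (counitHom adj ((tensFunctor S).obj (self R hR)) (Tens.tmul R x u)) := by
        refine DFunLike.congr_fun (Tens.hom_ext A
          (f := (contractRight S (evalAt (ev adj hA) u)
            (evalAt_leftLinear (ev_bilinear adj hA) u)).comp
            (Tens.map A (lmulMap R S) (AddMonoidHom.id T) (lmulMap_rightLinear R A S)
              (IsLeftLinear.id A)))
          (g := ((lmulMap R S).comp (counitHom adj ((tensFunctor S).obj (self R hR)))).comp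
            ((Tens.mk R (Tens A (Tens R R S) T) S).flip u)) fun y t => ?_) x
        exact (lmulMap_rightLinear R A S y _).symm.trans (congrArg (lmulMap R S)
          (counitHom_tmul adj hA ((tensFunctor S).obj (self R hR)) y t u).symm)
      exact (key (unitHom adj (self R hR) r)).trans
        (congrArg (lmulMap R S) (counitHom_unitHom adj (self R hR) r u)))
    (fun t r => by
      -- Lifting `t` to `A ⊗_A T` puts it in the image of `A` under `- ⊗_A T`, where the second
      -- triangle is available.
      obtain ⟨y, rfl⟩ := T.leftFirm.2 t
      have key (x : Tens A S T) :
          contractLeft T (evalBy (ev adj hA) (lmulMap A T y))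
            (evalBy_rightLinear (ev_bilinear adj hA) (lmulMap A T y)) x =
          lmulMap A T (Tens.map A (counitHom adj (self A hA)) (AddMonoidHom.id T)
            (counitHom_linear adj (self A hA)) (IsLeftLinear.id A)
            (Tens.assocInv A R (Tens A A T) S T (Tens.tmul R y x))) := by
        refine DFunLike.congr_fun (Tens.hom_ext A
          (f := contractLeft T (evalBy (ev adj hA) (lmulMap A T y))
            (evalBy_rightLinear (ev_bilinear adj hA) (lmulMap A T y)))
          (g := (lmulMap A T).comp ((Tens.map A (counitHom adj (self A hA)) (AddMonoidHom.id T)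
            (counitHom_linear adj (self A hA)) (IsLeftLinear.id A)).comp
            ((Tens.assocInv A R (Tens A A T) S T).comp (Tens.mk R (Tens A A T) (Tens A S T) y))))
          fun v t => ?_) x
        exact congrArg (fun a : A => a •ₗ t) (ev_lmulMap adj hA y v)
      refine (key (coev adj hR r)).trans (Eq.trans ?_ (lmulMap_rightLinear A R T y r))
      refine congrArg (lmulMap A T) (Eq.trans ?_ (map_counitHom_unitHom adj (self A hA) (y •ᵣ r)))
      exact congrArg _ (unitHom_rsmul adj hR ((tensFunctor T).obj (self A hA)) y r).symm)

end FirmMod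

end Adjunction

/-! ### The right adjoint `Hom_R(T, -) ⊗_A A` of `- ⊗_A T`. -/

section RHom

variable (R T M : Type*) [NonUnitalRing R] [AddCommGroup T] [AddCommGroup M] [RightModule R T]
  [RightModule R M]

/-- The group `Hom_R(T, M)` of right linear maps. -/
def RHom : AddSubgroup (T →+ M) where
  carrier := {f | IsRightLinear R f}
  zero_mem' := fun _ r => (zero_rsmul' r).symm
  add_mem' := fun {f g} hf hg t r => by
    rw [AddMonoidHom.add_apply, AddMonoidHom.add_apply, hf, hg, RightModule.add_rsmul]
  neg_mem' := fun {f} hf t r => by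
    rw [AddMonoidHom.neg_apply, AddMonoidHom.neg_apply, hf]
    exact (map_neg ((ractHom R M).flip r) (f t)).symm

variable {R T M}

/-- `(f a)(t) = f(a t)`. -/
instance {A : Type*} [NonUnitalRing A] [LeftModule A T] [Bimodule A R T] :
    RightModule A (RHom R T M) where
  rsmul f a := ⟨f.1.comp (lactHom A T a), fun t r => by
    rw [AddMonoidHom.comp_apply, AddMonoidHom.comp_apply, lactHom_apply, lactHom_apply,
      ← Bimodule.lsmul_rsmul, f.2]⟩
  add_rsmul f g a := rfl
  rsmul_add f a b := by
    ext t
    change f.1 ((a + b) •ₗ t) = f.1 (a •ₗ t) + f.1 (b •ₗ t)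
    rw [LeftModule.add_lsmul, map_add]
  rsmul_mul f a b := by
    ext t
    exact congrArg f.1 (LeftModule.mul_lsmul a b t)

end RHom

namespace FirmMod

variable {R A : Type u} [NonUnitalRing R] [NonUnitalRing A]

/-- The firm module `Hom_R(T, M) ⊗_A A`. -/
def coHom (hA : IsFirmRing A) (T : FirmBimodule A R) (M : FirmMod R) : FirmMod A :=
  ⟨Tens A (RHom R T M) A, IsRightFirm.tens A A (RHom R T M) A hA⟩

variable {T : FirmBimodule A R} {N : FirmMod A} {M : FirmMod R}

/-- The map `n ↦ h(n ⊗ -)`. -/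
def curry (h : (tensFunctor T).obj N ⟶ M) : N →+ RHom R T M :=
  AddMonoidHom.mk' (fun n => ⟨(h.hom : Tens A N T →+ M).comp (Tens.mk A N T n),
      fun t r => h.linear (Tens.tmul A n t) r⟩)
    (fun n n' => Subtype.ext (AddMonoidHom.ext fun t =>
      (congrArg h.hom (Tens.add_tmul A n n' t)).trans (map_add h.hom _ _)))

theorem curry_linear (h : (tensFunctor T).obj N ⟶ M) : IsRightLinear A (curry h) :=
  fun n a => Subtype.ext (AddMonoidHom.ext fun t => congrArg h.hom (Tens.rsmul_tmul A n a t))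

/-- The map `n a ↦ h(n ⊗ -) ⊗ a`. -/
noncomputable def curryFirm (h : (tensFunctor T).obj N ⟶ M) : N →+ Tens A (RHom R T M) A :=
  N.firm.lift ((Tens.mk A (RHom R T M) A).comp (curry h)) (fun n a b => by
    rw [AddMonoidHom.comp_apply, curry_linear]
    exact Tens.rsmul_tmul A (curry h n) a b)

theorem curryFirm_rsmul (h : (tensFunctor T).obj N ⟶ M) (n : N) (a : A) :
    curryFirm h (n •ᵣ a) = Tens.tmul A (curry h n) a :=
  N.firm.lift_rsmul _ _ n a

theorem curryFirm_linear (h : (tensFunctor T).obj N ⟶ M) : IsRightLinear A (curryFirm h) := by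
  intro x a
  induction x using N.firm.induction with
  | h0 => rw [zero_rsmul', map_zero, zero_rsmul']
  | hs n b => rw [← RightModule.rsmul_mul, curryFirm_rsmul, curryFirm_rsmul]; rfl
  | ha x y hx hy => rw [RightModule.add_rsmul, map_add, map_add, hx, hy, RightModule.add_rsmul]

theorem rmulMap_curryFirm (h : (tensFunctor T).obj N ⟶ M) (n : N) :
    rmulMap A (RHom R T M) (curryFirm h n) = curry h n := by
  induction n using N.firm.induction with
  | h0 => simp only [map_zero]
  | hs n b => rw [curryFirm_rsmul, curry_linear]; rfl
  | ha x y hx hy => simp only [map_add, hx, hy]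

/-- The map `n ⊗ t ↦ k(n)(t)`. -/
def uncurry (k : N →+ RHom R T M) (hk : IsRightLinear A k) : Tens A N T →+ M :=
  Tens.lift A ((RHom R T M).subtype.comp k)
    (fun n a t => congrArg (fun f : RHom R T M => f.1 t) (hk n a))

theorem uncurry_linear (k : N →+ RHom R T M) (hk : IsRightLinear A k) :
    IsRightLinear R (uncurry k hk) := by
  intro x r
  induction x using Tens.induction with
  | h0 => rw [zero_rsmul', map_zero, zero_rsmul']
  | ht n t => exact (k n).2 t r
  | ha x y hx hy => rw [RightModule.add_rsmul, map_add, map_add, hx, hy, RightModule.add_rsmul]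

theorem rmulMap_comp_linear {X : Type*} [AddCommGroup X] [RightModule A X] (g : N →+ Tens A X A)
    (hg : IsRightLinear A g) : IsRightLinear A ((rmulMap A X).comp g) := fun n a =>
  (congrArg (rmulMap A X) (hg n a)).trans (rmulMap_rightLinear A X (g n) a)

/-- The bijection `Hom_R(N ⊗_A T, M) ≅ Hom_A(N, Hom_R(T, M) ⊗_A A)`. -/
noncomputable def curryEquiv (hA : IsFirmRing A) (T : FirmBimodule A R) (N : FirmMod A)
    (M : FirmMod R) : ((tensFunctor T).obj N ⟶ M) ≃ (N ⟶ coHom hA T M) where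
  toFun h := Hom.mk (N := coHom hA T M) (curryFirm h) (curryFirm_linear h)
  invFun g := Hom.mk (M := (tensFunctor T).obj N)
    (uncurry ((rmulMap A (RHom R T M)).comp g.hom) (rmulMap_comp_linear g.hom g.linear))
    (uncurry_linear _ _)
  left_inv h := Hom.ext (Tens.hom_ext A fun n t =>
    congrArg (fun f : RHom R T M => f.1 t) (rmulMap_curryFirm h n))
  -- In `X ⊗_A A` one has `x a = x' ⊗ a` with `x'` the product of `x` in `X`. Hence a linear map
  -- from a firm module to `X ⊗_A A` is determined by its composite to `X`, although `X ⊗_A A → X`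
  -- need not be injective.
  right_inv g := Hom.ext (N.firm.hom_ext fun n a => by
    refine (curryFirm_rsmul _ n a).trans (Eq.trans ?_ (g.linear n a).symm)
    exact (Tens.rsmul_eq_rmulMap_tmul (g.hom n : Tens A (RHom R T M) A) a).symm)

theorem curryEquiv_naturality (hA : IsFirmRing A) (T : FirmBimodule A R) (N' N : FirmMod A)
    (M : FirmMod R) (f : N' ⟶ N) (g : (tensFunctor T).obj N ⟶ M) :
    curryEquiv hA T N' M ((tensFunctor T).map f ≫ g) = f ≫ curryEquiv hA T N M g :=
  Hom.ext (N'.firm.hom_ext fun n a => by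
    refine (curryFirm_rsmul _ n a).trans (Eq.trans ?_ (congrArg (curryFirm g) (f.linear n a)).symm)
    exact (curryFirm_rsmul g (f.hom n) a).symm)

theorem valueAtRingIso_tensFunctor (hR : IsFirmRing R) (S : FirmBimodule R A) :
    ValueAtRingIso hR (tensFunctor S) S :=
  ⟨AddEquiv.ofBijective (lmulMap R S) S.leftFirm, lmulMap_rightLinear R A S, fun r x =>
    DFunLike.congr_fun (Tens.hom_ext R
      (f := (lmulMap R S).comp (((tensFunctor S).map (mulLeft hR r)).hom :
        Tens R R S →+ Tens R R S))
      (g := (lactHom R S r).comp (lmulMap R S))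
      fun s u => LeftModule.mul_lsmul r s u) x⟩

theorem hasAdjointTriple_of_adjunction (hR : IsFirmRing R) (hA : IsFirmRing A)
    {S : FirmBimodule R A} {T : FirmBimodule A R} (adj : tensFunctor S ⊣ tensFunctor T) :
    HasAdjointTriple hR S :=
  ⟨tensFunctor S, tensFunctor T, _, ⟨adj⟩,
    ⟨Adjunction.adjunctionOfEquivRight (curryEquiv hA T) (curryEquiv_naturality hA T)⟩,
    valueAtRingIso_tensFunctor hR S⟩

end FirmMod

/-! ### Additive structure of the category of firm modules. -/

namespace FirmMod

section Preadditive

variable {R : Type u} [NonUnitalRing R]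

namespace Hom

variable {M N : FirmMod R}

theorem hom_injective : Function.Injective (Hom.hom : Hom M N → (M →+ N)) := fun _ _ => Hom.ext

instance : Zero (Hom M N) := ⟨⟨0, fun _ r => (zero_rsmul' r).symm⟩⟩

instance : Add (Hom M N) := ⟨fun f g => ⟨f.hom + g.hom, (RHom R M N).add_mem f.linear g.linear⟩⟩

instance : Neg (Hom M N) := ⟨fun f => ⟨-f.hom, (RHom R M N).neg_mem f.linear⟩⟩

instance : Sub (Hom M N) := ⟨fun f g => ⟨f.hom - g.hom, (RHom R M N).sub_mem f.linear g.linear⟩⟩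

instance : SMul ℕ (Hom M N) := ⟨fun n f => ⟨n • f.hom, (RHom R M N).nsmul_mem f.linear n⟩⟩

instance : SMul ℤ (Hom M N) := ⟨fun n f => ⟨n • f.hom, (RHom R M N).zsmul_mem f.linear n⟩⟩

instance : AddCommGroup (Hom M N) :=
  hom_injective.addCommGroup _ rfl (fun _ _ => rfl) (fun _ => rfl) (fun _ _ => rfl)
    (fun _ _ => rfl) (fun _ _ => rfl)

end Hom

instance : Preadditive (FirmMod R) where
  homGroup M N := inferInstanceAs (AddCommGroup (Hom M N))
  add_comp _ _ _ f g h := Hom.ext (AddMonoidHom.ext fun x => map_add h.hom (f.hom x) (g.hom x))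
  comp_add _ _ _ _ _ _ := rfl

instance (M N : Type*) [AddCommGroup M] [AddCommGroup N] [RightModule R M] [RightModule R N] :
    RightModule R (M × N) where
  rsmul x r := (x.1 •ᵣ r, x.2 •ᵣ r)
  add_rsmul _ _ r := Prod.ext (RightModule.add_rsmul _ _ r) (RightModule.add_rsmul _ _ r)
  rsmul_add _ r s := Prod.ext (RightModule.rsmul_add _ r s) (RightModule.rsmul_add _ r s)
  rsmul_mul _ r s := Prod.ext (RightModule.rsmul_mul _ r s) (RightModule.rsmul_mul _ r s)

theorem isRightFirm_prod {M N : Type*} [AddCommGroup M] [AddCommGroup N] [RightModule R M]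
    [RightModule R N] (hM : IsRightFirm R M) (hN : IsRightFirm R N) : IsRightFirm R (M × N) := by
  have hi : IsRightLinear R (AddMonoidHom.inl M N) := fun m r =>
    Prod.ext rfl (zero_rsmul' r).symm
  have hj : IsRightLinear R (AddMonoidHom.inr M N) := fun m r =>
    Prod.ext (zero_rsmul' r).symm rfl
  let p := Tens.map R (AddMonoidHom.fst M N) (AddMonoidHom.id R) (fun _ _ => rfl)
    (IsLeftLinear.id R)
  let q := Tens.map R (AddMonoidHom.snd M N) (AddMonoidHom.id R) (fun _ _ => rfl)
    (IsLeftLinear.id R)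
  let i := Tens.map R (AddMonoidHom.inl M N) (AddMonoidHom.id R) hi (IsLeftLinear.id R)
  let j := Tens.map R (AddMonoidHom.inr M N) (AddMonoidHom.id R) hj (IsLeftLinear.id R)
  have hpq (x : Tens R (M × N) R) : i (p x) + j (q x) = x :=
    DFunLike.congr_fun (Tens.hom_ext R (f := i.comp p + j.comp q) (g := AddMonoidHom.id _)
      fun m r => by
        refine (Tens.add_tmul R _ _ r).symm.trans (congrArg (fun m => Tens.tmul R m r) ?_)
        exact Prod.ext (add_zero m.1) (zero_add m.2)) x
  have hp (x : Tens R (M × N) R) : rmulMap R M (p x) = (rmulMap R (M × N) x).1 :=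
    DFunLike.congr_fun (Tens.hom_ext R (f := (rmulMap R M).comp p)
      (g := (AddMonoidHom.fst M N).comp (rmulMap R (M × N))) fun _ _ => rfl) x
  have hq (x : Tens R (M × N) R) : rmulMap R N (q x) = (rmulMap R (M × N) x).2 :=
    DFunLike.congr_fun (Tens.hom_ext R (f := (rmulMap R N).comp q)
      (g := (AddMonoidHom.snd M N).comp (rmulMap R (M × N))) fun _ _ => rfl) x
  refine ⟨fun x y h => ?_, fun y => ?_⟩
  · rw [← hpq x, ← hpq y, hM.1 (((hp x).trans (congrArg Prod.fst h)).trans (hp y).symm),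
      hN.1 (((hq x).trans (congrArg Prod.snd h)).trans (hq y).symm)]
  · obtain ⟨a, ha⟩ := hM.2 y.1
    obtain ⟨b, hb⟩ := hN.2 y.2
    refine ⟨i a + j b, ?_⟩
    have hia : rmulMap R (M × N) (i a) = AddMonoidHom.inl M N (rmulMap R M a) :=
      DFunLike.congr_fun (Tens.hom_ext R (f := (rmulMap R (M × N)).comp i)
        (g := (AddMonoidHom.inl M N).comp (rmulMap R M)) fun m r => (hi m r).symm) a
    have hjb : rmulMap R (M × N) (j b) = AddMonoidHom.inr M N (rmulMap R N b) :=
      DFunLike.congr_fun (Tens.hom_ext R (f := (rmulMap R (M × N)).comp j)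
        (g := (AddMonoidHom.inr M N).comp (rmulMap R N)) fun m r => (hj m r).symm) b
    rw [map_add, hia, hjb, ha, hb]
    exact Prod.ext (add_zero y.1) (zero_add y.2)

/-- The product of two firm modules as a biproduct. -/
def binaryBicone (M N : FirmMod R) : Limits.BinaryBicone M N where
  pt := ⟨M × N, isRightFirm_prod M.firm N.firm⟩
  fst := Hom.mk (M := ⟨M × N, isRightFirm_prod M.firm N.firm⟩) (AddMonoidHom.fst M N)
    (fun _ _ => rfl)
  snd := Hom.mk (M := ⟨M × N, isRightFirm_prod M.firm N.firm⟩) (AddMonoidHom.snd M N)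
    (fun _ _ => rfl)
  inl := Hom.mk (N := ⟨M × N, isRightFirm_prod M.firm N.firm⟩) (AddMonoidHom.inl M N)
    (fun _ r => Prod.ext rfl (zero_rsmul' r).symm)
  inr := Hom.mk (N := ⟨M × N, isRightFirm_prod M.firm N.firm⟩) (AddMonoidHom.inr M N)
    (fun _ r => Prod.ext (zero_rsmul' r).symm rfl)

instance : Limits.HasBinaryBiproducts (FirmMod R) where
  has_binary_biproduct M N := .mk
    { bicone := binaryBicone M N
      isBilimit := Limits.isBinaryBilimitOfTotal _ (Hom.ext (AddMonoidHom.ext fun x =>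
        Prod.ext (add_zero x.1) (zero_add x.2))) }

instance : RightModule R PUnit.{u + 1} where
  rsmul _ _ := 0
  add_rsmul _ _ _ := rfl
  rsmul_add _ _ _ := rfl
  rsmul_mul _ _ _ := rfl

theorem isRightFirm_punit : IsRightFirm R PUnit.{u + 1} := by
  have h0 (x : Tens R PUnit.{u + 1} R) : x = 0 :=
    DFunLike.congr_fun (Tens.hom_ext R (f := AddMonoidHom.id _) (g := 0)
      fun m r => Tens.zero_tmul R r) x
  exact ⟨fun x y _ => (h0 x).trans (h0 y).symm, fun _ => ⟨0, rfl⟩⟩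

instance : Limits.HasZeroObject (FirmMod R) :=
  ⟨⟨PUnit.{u + 1}, isRightFirm_punit⟩, (Limits.IsZero.iff_id_eq_zero _).2
    (Hom.ext (AddMonoidHom.ext fun _ => rfl))⟩

/-- Left adjoints preserve binary coproducts, which here are biproducts, and addition of morphisms
is expressible through biproducts. Additivity is needed to compare `F` with a tensor functor. -/
theorem additive_of_adjunction {A : Type u} [NonUnitalRing A] {F : FirmMod R ⥤ FirmMod A}
    {G : FirmMod A ⥤ FirmMod R} (adj : F ⊣ G) : F.Additive := by
  have := adj.leftAdjoint_preservesColimits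
  have := Limits.preservesBinaryBiproducts_of_preservesBinaryCoproducts F
  exact Functor.additive_of_preservesBinaryBiproducts F

end Preadditive

end FirmMod

/-! ### Eilenberg-Watts for firm modules. -/

namespace FirmMod

variable {R A : Type u} [NonUnitalRing R] [NonUnitalRing A]

theorem orbit_add (hR : IsFirmRing R) {M : FirmMod R} (m m' : M) :
    orbit hR (m + m') = orbit hR m + orbit hR m' :=
  Hom.ext (map_add (ractHom R M) m m')

theorem orbit_rsmul (hR : IsFirmRing R) {M : FirmMod R} (m : M) (r : R) :
    orbit hR (m •ᵣ r) = mulLeft hR r ≫ orbit hR m :=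
  Hom.ext (AddMonoidHom.ext fun s => (RightModule.rsmul_mul m r s).symm)

theorem orbit_comp (hR : IsFirmRing R) {M N : FirmMod R} (m : M) (f : M ⟶ N) :
    orbit hR m ≫ f = orbit hR (f.hom m) :=
  Hom.ext (AddMonoidHom.ext fun r => f.linear m r)

theorem mulLeft_add (hR : IsFirmRing R) (r s : R) :
    mulLeft hR (r + s) = mulLeft hR r + mulLeft hR s :=
  Hom.ext (AddMonoidHom.ext fun t => add_mul r s t)

theorem mulLeft_mul (hR : IsFirmRing R) (r s : R) :
    mulLeft hR (r * s) = mulLeft hR s ≫ mulLeft hR r :=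
  Hom.ext (AddMonoidHom.ext fun t => mul_assoc r s t)

/-- The maps `r ↦ m r` from `R` to `M` are jointly epimorphic because the products `m r` generate
`M`. -/
theorem hom_ext_orbit (hR : IsFirmRing R) {M N : FirmMod R} {f g : M ⟶ N}
    (h : ∀ m : M, orbit hR m ≫ f = orbit hR m ≫ g) : f = g :=
  Hom.ext (M.firm.hom_ext fun m r => congrArg (fun k => k.hom r) (h m))

theorem bijective_of_isIso {M N : FirmMod R} (f : M ⟶ N) [IsIso f] :
    Function.Bijective f.hom :=
  ⟨Function.LeftInverse.injective (g := (inv f).hom) fun x =>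
      congrArg (fun k => k.hom x) (IsIso.hom_inv_id f),
    Function.RightInverse.surjective (g := (inv f).hom) fun x =>
      congrArg (fun k => k.hom x) (IsIso.inv_hom_id f)⟩

section EilenbergWatts

theorem symm_rsmul {X S : Type*} [AddCommGroup X] [AddCommGroup S] [RightModule A X]
    [RightModule A S] (e : X ≃+ S) (he : IsRightLinear A e.toAddMonoidHom) (u : S) (a : A) :
    e.symm (u •ᵣ a) = e.symm u •ᵣ a :=
  (AddEquiv.symm_apply_eq e).2 (((he (e.symm u) a).trans
    (congrArg (· •ᵣ a) (e.apply_symm_apply u))).symm)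

theorem symm_lsmul (hR : IsFirmRing R) (F : FirmMod R ⥤ FirmMod A) {S : Type*} [AddCommGroup S]
    [LeftModule R S] (e : F.obj (self R hR) ≃+ S)
    (he' : ∀ (r : R) (x : F.obj (self R hR)), e ((F.map (mulLeft hR r)).hom x) = r •ₗ e x)
    (r : R) (u : S) : e.symm (r •ₗ u) = (F.map (mulLeft hR r)).hom (e.symm u) :=
  (AddEquiv.symm_apply_eq e).2 (((he' r (e.symm u)).trans
    (congrArg (r •ₗ ·) (e.apply_symm_apply u))).symm)

variable (hR : IsFirmRing R) (F : FirmMod R ⥤ FirmMod A) [F.Additive] {S : Type u} [AddCommGroup S]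
  [LeftModule R S] [RightModule A S] [Bimodule R A S] (e : F.obj (self R hR) ≃+ S)
  (he : IsRightLinear A e.toAddMonoidHom)
  (he' : ∀ (r : R) (x : F.obj (self R hR)), e ((F.map (mulLeft hR r)).hom x) = r •ₗ e x)
  (hS : IsRightFirm A S)

/-- The comparison map `M ⊗_R F(R) → F(M)`. -/
def wattsHom (M : FirmMod R) : Tens R M S →+ F.obj M :=
  Tens.lift R
    (AddMonoidHom.mk' (fun m => (F.map (orbit hR m)).hom.comp e.symm.toAddMonoidHom)
      (fun m m' => by
        rw [orbit_add, F.map_add]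
        rfl))
    (fun m r u => by
      change (F.map (orbit hR (m •ᵣ r))).hom (e.symm u) =
        (F.map (orbit hR m)).hom (e.symm (r •ₗ u))
      rw [symm_lsmul hR F e he', orbit_rsmul, F.map_comp]
      rfl)

/-- The comparison map as a morphism of firm modules. -/
def watts (M : FirmMod R) : (⟨Tens R M S, IsRightFirm.tens R A M S hS⟩ : FirmMod A) ⟶ F.obj M :=
  Hom.mk (M := ⟨Tens R M S, IsRightFirm.tens R A M S hS⟩) (wattsHom hR F e he' M) (fun x a => by
    induction x using Tens.induction with
    | h0 => rw [zero_rsmul', map_zero, zero_rsmul']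
    | ht m u =>
      exact (congrArg (F.map (orbit hR m)).hom (symm_rsmul e he u a)).trans
        ((F.map (orbit hR m)).linear (e.symm u) a)
    | ha x y hx hy => rw [RightModule.add_rsmul, map_add, map_add, hx, hy, RightModule.add_rsmul])

/-- The Eilenberg-Watts theorem for firm modules. -/
theorem isIso_watts {G : FirmMod A ⥤ FirmMod R} (adj : F ⊣ G) (M : FirmMod R) :
    IsIso (watts hR F e he he' hS M) := by
  -- By Yoneda it suffices to compare morphisms into each `N`. Those out of `F(M)` correspond to
  -- morphisms `M → G(N)`, which firmness describes through the maps `r ↦ m r`.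
  refine isIso_of_coyoneda_map_bijective _ fun N => ⟨fun f g hfg => ?_, fun h => ?_⟩
  · refine (adj.homEquiv M N).injective (hom_ext_orbit hR fun m => ?_)
    rw [← adj.homEquiv_naturality_left, ← adj.homEquiv_naturality_left]
    refine congrArg _ (Hom.ext (AddMonoidHom.ext fun x => ?_))
    have := congrArg (fun k => k.hom (Tens.tmul R m (e x))) hfg
    change f.hom ((F.map (orbit hR m)).hom (e.symm (e x))) =
      g.hom ((F.map (orbit hR m)).hom (e.symm (e x))) at this
    rwa [e.symm_apply_apply] at this
  · let h' : Tens R M S →+ N := h.hom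
    -- A morphism `h` on `M ⊗_R S` is split into the family `h(m ⊗ -)` of morphisms `F(R) → N`.
    -- Their adjuncts `q m : R → G(N)` are additive in `m` and balanced, so they glue to `k : M →
    -- G(N)`, whose adjunct is the required extension.
    let p (m : M) : F.obj (self R hR) ⟶ N :=
      ⟨(h'.comp (Tens.mk R M S m)).comp e.toAddMonoidHom, fun x a =>
        (congrArg (fun u => h' (Tens.tmul R m u)) (he x a)).trans (h.linear (Tens.tmul R m (e x)) a)⟩
    have hp_add (m m' : M) : p (m + m') = p m + p m' :=
      Hom.ext (AddMonoidHom.ext fun x =>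
        (congrArg h' (Tens.add_tmul R m m' (e x))).trans (map_add h' _ _))
    have hp_mul (m : M) (r : R) : p (m •ᵣ r) = F.map (mulLeft hR r) ≫ p m :=
      Hom.ext (AddMonoidHom.ext fun x => congrArg h'
        ((Tens.rsmul_tmul R m r (e x)).trans (congrArg (Tens.tmul R m) (he' r x).symm)))
    let q (m : M) : self R hR ⟶ G.obj N := adj.homEquiv _ _ (p m)
    have hq_add (m m' : M) : q (m + m') = q m + q m' :=
      (congrArg _ (hp_add m m')).trans (adj.homAddEquiv_add _ _ _ _)
    have hq_mul (m : M) (r : R) : q (m •ᵣ r) = mulLeft hR r ≫ q m :=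
      (congrArg _ (hp_mul m r)).trans (adj.homEquiv_naturality_left _ _)
    let b : M →+ R →+ G.obj N := AddMonoidHom.mk' (fun m => (q m).hom)
      (fun m m' => congrArg Hom.hom (hq_add m m'))
    have hb (m : M) (r s : R) : b (m •ᵣ r) s = b m (r * s) :=
      congrArg (fun k => k.hom s) (hq_mul m r)
    have hk (m : M) (r : R) : M.firm.lift b hb (m •ᵣ r) = (q m).hom r :=
      M.firm.lift_rsmul b hb m r
    let k : M ⟶ G.obj N := ⟨M.firm.lift b hb, fun x r => by
      induction x using M.firm.induction with
      | h0 => rw [zero_rsmul', map_zero, zero_rsmul']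
      | hs m s =>
        rw [← RightModule.rsmul_mul, hk, hk]
        exact (q m).linear s r
      | ha x y hx hy =>
        rw [RightModule.add_rsmul, map_add, map_add, hx, hy, RightModule.add_rsmul]⟩
    have hkq (m : M) : orbit hR m ≫ k = q m := Hom.ext (AddMonoidHom.ext fun r => hk m r)
    refine ⟨(adj.homEquiv M N).symm k, Hom.ext (Tens.hom_ext R fun m u => ?_)⟩
    have : F.map (orbit hR m) ≫ (adj.homEquiv M N).symm k = p m := by
      rw [← adj.homEquiv_naturality_left_symm, hkq]
      exact (adj.homEquiv _ _).symm_apply_apply (p m)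
    refine (congrArg (fun f => f.hom (e.symm u)) this).trans ?_
    exact congrArg (fun v => h' (Tens.tmul R m v)) (e.apply_symm_apply u)

end EilenbergWatts

/-- A left adjoint functor `F` is isomorphic to `- ⊗_R S` if `F(R) ≅ S`. -/
theorem nonempty_tensFunctor_iso (hR : IsFirmRing R) {F : FirmMod R ⥤ FirmMod A}
    {G : FirmMod A ⥤ FirmMod R} (adj : F ⊣ G) (S : FirmBimodule R A) (h : ValueAtRingIso hR F S) :
    Nonempty (tensFunctor S ≅ F) := by
  obtain ⟨e, he, he'⟩ := h
  have := additive_of_adjunction adj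
  have := isIso_watts hR F e he he' S.rightFirm adj
  refine ⟨NatIso.ofComponents (fun M => @asIso _ _ _ _ _ (this M))
    fun {M N} f => Hom.ext (Tens.hom_ext R fun m u => ?_)⟩
  -- Naturality on `m ⊗ u`: following `r ↦ m r` by `f` gives `r ↦ f(m) r`.
  change (F.map (orbit hR (f.hom m))).hom (e.symm u) =
    (F.map (orbit hR m) ≫ F.map f).hom (e.symm u)
  rw [← F.map_comp, orbit_comp]

/-- The value at `R` of a left adjoint functor is a firm bimodule. -/
theorem exists_valueAtRingIso (hR : IsFirmRing R) {F : FirmMod R ⥤ FirmMod A}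
    {G : FirmMod A ⥤ FirmMod R} (adj : F ⊣ G) :
    ∃ S : FirmBimodule R A, ValueAtRingIso hR F S := by
  have := additive_of_adjunction adj
  let X := F.obj (self R hR)
  let : LeftModule R X :=
    { lsmul := fun r x => (F.map (mulLeft hR r)).hom x
      lsmul_add := fun r => map_add _
      add_lsmul := fun r s x => by rw [mulLeft_add, F.map_add]; rfl
      mul_lsmul := fun r s x => by rw [mulLeft_mul, F.map_comp]; rfl }
  have : Bimodule R A X := ⟨fun r x a => ((F.map (mulLeft hR r)).linear x a).symm⟩
  have he : IsRightLinear A (AddEquiv.refl X).toAddMonoidHom := fun _ _ => rfl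
  have he' : ∀ (r : R) (x : X),
      AddEquiv.refl X ((F.map (mulLeft hR r)).hom x) = r •ₗ AddEquiv.refl X x := fun _ _ => rfl
  have := isIso_watts hR F (AddEquiv.refl X) he he' X.firm adj (self R hR)
  -- For `M = R` the map attached to `m` is left multiplication by `m`, so the comparison map is the
  -- multiplication map `R ⊗_R F(R) → F(R)`; its bijectivity is left firmness.
  have hl : IsLeftFirm R X := by
    have h : (watts hR F (AddEquiv.refl X) he he' X.firm (self R hR)).hom = lmulMap R X :=
      Tens.hom_ext R fun _ _ => rfl
    have hb := bijective_of_isIso (watts hR F (AddEquiv.refl X) he he' X.firm (self R hR))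
    rw [h] at hb
    exact hb
  exact ⟨⟨X, hl, X.firm⟩, AddEquiv.refl X, he, he'⟩

/-- The adjunction `G ⊣ H` makes `G` itself a left adjoint, so `T` can be taken to be `G(A)`; then
`F ⊣ G` is transported along the two natural isomorphisms. -/
theorem exists_adjunction_of_hasAdjointTriple (hR : IsFirmRing R) (hA : IsFirmRing A)
    {S : FirmBimodule R A} (h : HasAdjointTriple hR S) :
    ∃ T : FirmBimodule A R, Nonempty (tensFunctor S ⊣ tensFunctor T) := by
  obtain ⟨F, G, H, ⟨adj⟩, ⟨adj'⟩, hS⟩ := h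
  obtain ⟨T, hT⟩ := exists_valueAtRingIso hA adj'
  obtain ⟨i⟩ := nonempty_tensFunctor_iso hR adj S hS
  obtain ⟨j⟩ := nonempty_tensFunctor_iso hA adj' T hT
  exact ⟨T, ⟨(adj.ofNatIsoLeft i.symm).ofNatIsoRight j.symm⟩⟩

end FirmMod

end FirmRings

theorem theorem2p4 (R A : Type u) [NonUnitalRing R] [NonUnitalRing A]
    (hR : IsFirmRing R) (hA : IsFirmRing A) (S : FirmBimodule R A) :
    List.TFAE [
      IsFirmlyProjective A S R,
      ∃ T : FirmBimodule A R, Nonempty (ComatrixCoringContext R A S T),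
      ∃ T : FirmBimodule A R,
        Nonempty (FirmMod.tensFunctor S ⊣ FirmMod.tensFunctor T),
      HasAdjointTriple hR S] ∧
    ∀ T : FirmBimodule A R,
      List.TFAE [
        IsFirmlyProjective A S R ∧ BimoduleIso A R T (Tens R (Dual A S) R),
        Nonempty (ComatrixCoringContext R A S T),
        Nonempty (FirmMod.tensFunctor S ⊣ FirmMod.tensFunctor T)] := by
  constructor
  · tfae_have 1 → 2 := fun h => by
      obtain ⟨ι, hι, -⟩ := id h
      exact ⟨FirmBimodule.dualTens hR ι hι, nonempty_context_of_iso hR _ h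
        ⟨AddEquiv.refl _, fun _ _ => rfl, fun _ _ => rfl⟩⟩
    tfae_have 2 → 1 := fun ⟨_, ⟨c⟩⟩ => c.isFirmlyProjective
    tfae_have 2 → 3 := fun ⟨T, ⟨c⟩⟩ => ⟨T, ⟨c.adjunction⟩⟩
    tfae_have 3 → 2 := fun ⟨T, ⟨adj⟩⟩ => ⟨T, ⟨FirmMod.contextOfAdjunction adj hR hA⟩⟩
    tfae_have 3 → 4 := fun ⟨_, ⟨adj⟩⟩ => FirmMod.hasAdjointTriple_of_adjunction hR hA adj
    tfae_have 4 → 3 := FirmMod.exists_adjunction_of_hasAdjointTriple hR hA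
    tfae_finish
  · intro T
    tfae_have 1 → 2 := fun ⟨h, hT⟩ => nonempty_context_of_iso hR T h hT
    tfae_have 2 → 1 := fun ⟨c⟩ => ⟨c.isFirmlyProjective, c.bimoduleIso hR⟩
    tfae_have 2 → 3 := fun ⟨c⟩ => ⟨c.adjunction⟩
    tfae_have 3 → 2 := fun ⟨adj⟩ => ⟨FirmMod.contextOfAdjunction adj hR hA⟩
    tfae_finish
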